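/- Let $A$ and $B$ be $C^*$-algebras (not necessarily unital), let $F$ be an operator $A$-$B$ bimodule, and let $X$ and $Y$ be left operator $B$-modules; no nondegeneracy is assumed. Here an operator space is a complex Banach space $V$ with norms $\|\cdot\|$ on the matrix spaces $M_{m,n}(V)$ (the given norm for $m=n=1$) satisfying Ruan's axioms $\|\alpha v\beta\|\le\|\alpha\|\,\|v\|\,\|\beta\|$ for scalar matrices $\alpha,\beta$ and $\|v\oplus w\|=\max(\|v\|,\|w\|)$, for example a norm-closed space of bounded operators on a Hilbert space $H$ with the operator norms of $M_{m,n}(\mathrm B(H))=\mathrm B(H^n,H^m)$. A left operator $B$-module is an operator space $X$ with a left $B$-action such that $\|bx\|\le\|b\|\,\|x\|$ for all $n\ge 1$, $b\in M_n(B)$, $x\in M_n(X)$; right modules and bimodules are defined analogously. For left operator $B$-modules $X,Y$ let $\operatorname{CB}_B(X,Y)$ be the space of $B$-linear maps $t:X\to Y$ with $\|t\|_{\mathrm{cb}}=\sup_k\|t_k:M_k(X)\to M_k(Y)\|<\infty$, with the matrix norms for which the norm of $[t_{ij}]\in M_n(\operatorname{CB}_B(X,Y))$ is the completely bounded norm of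 the map $X\to M_n(Y)$, $x\mapsto[t_{ij}(x)]$, where $M_k(M_n(Y))=M_{kn}(Y)$. Let $F\otimes^h_B X$ be the Haagerup tensor product: the completion of the algebraic $B$-balanced tensor product in the matrix seminorms $$\|u\|=\inf\Big\{\|f\|\,\|x\| : p\ge 0,\ f\in M_{m,p}(F),\ x\in M_{p,n}(X),\ u_{ij}=\sum_{k=1}^p f_{ik}\otimes x_{kj}\Big\},\qquad u\in M_{m,n}(F\otimes_B^{\mathrm{alg}}X),$$ which is a left operator $A$-module with $a(f\otimes x)=(af)\otimes x$. **Lemma.** The linear map $$\operatorname{CB}_B(X,Y)\to\operatorname{CB}_A(F\otimes^h_B X,\ F\otimes^h_B Y),\qquad t\mapsto \mathrm{id}_F\otimes t,$$ where $\mathrm{id}_F\otimes t$ is the continuous extension of $f\otimes x\mapsto f\otimes t(x)$, is completely contractive: for every $n\ge1$ and every $[t_{ij}]\in M_n(\operatorname{CB}_B(X,Y))$ one has $\|[\mathrm{id}_F\otimes t_{ij}]\|\le\|[t_{ij}]\|$. -/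

import Mathlib

open scoped TensorProduct

noncomputable section

namespace OpSp

open scoped Matrix.Norms.L2Operator

/-- The product `α x` of a scalar matrix `α` and a matrix `x` over a complex vector space. -/
def scalarMul {k m n : Type} [Fintype m] {V : Type*} [AddCommGroup V] [Module ℂ V]
    (α : Matrix k m ℂ) (x : Matrix m n V) : Matrix k n V :=
  fun i j => ∑ p, α i p • x p j

/-- The product `x β` of a matrix `x` over a complex vector space and a scalar matrix `β`. -/
def mulScalar {m n l : Type} [Fintype n] {V : Type*} [AddCommGroup V] [Module ℂ V]
    (x : Matrix m n V) (β : Matrix n l ℂ) : Matrix m l V :=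
  fun i j => ∑ q, β q j • x i q

/-- A family of real valued functions on the matrix spaces `M_{m,n}(V)`, where `m` and `n` run
over the finite index types. -/
class MatrixNorms (V : Type*) where
  /-- the norm of a rectangular matrix with entries in `V` -/
  mnorm : ∀ {m n : Type} [Fintype m] [Fintype n], Matrix m n V → ℝ

open MatrixNorms (mnorm)

/-- A complex vector space with matrix seminorms satisfying Ruan's axioms
`‖α x β‖ ≤ ‖α‖ ‖x‖ ‖β‖` and `‖x ⊕ y‖ = max ‖x‖ ‖y‖`. Here `‖α‖` is the norm of the scalar
matrix `α` as an operator between finite dimensional Hilbert spaces. -/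
class RuanSpace (V : Type*) [AddCommGroup V] [Module ℂ V] extends MatrixNorms V where
  mnorm_add_le : ∀ {m n : Type} [Fintype m] [Fintype n] (x y : Matrix m n V),
    mnorm (x + y) ≤ mnorm x + mnorm y
  mnorm_scalarMul_le : ∀ {k m n : Type} [Fintype k] [Fintype m] [Fintype n] [DecidableEq m]
    (α : Matrix k m ℂ) (x : Matrix m n V), mnorm (scalarMul α x) ≤ ‖α‖ * mnorm x
  mnorm_mulScalar_le : ∀ {m n l : Type} [Fintype m] [Fintype n] [Fintype l] [DecidableEq l]
    (x : Matrix m n V) (β : Matrix n l ℂ), mnorm (mulScalar x β) ≤ mnorm x * ‖β‖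
  mnorm_fromBlocks : ∀ {k l m n : Type} [Fintype k] [Fintype l] [Fintype m] [Fintype n]
    (x : Matrix k l V) (y : Matrix m n V),
    mnorm (Matrix.fromBlocks x 0 0 y) = max (mnorm x) (mnorm y)

/-- An operator space: a complex Banach space with matrix norms that satisfy Ruan's axioms and
that restrict to the given norm on `M₁(X) = X`. -/
class OperatorSpace (X : Type*) [NormedAddCommGroup X] [NormedSpace ℂ X] extends
    RuanSpace X, CompleteSpace X where
  mnorm_one_one : ∀ x : X, mnorm (fun _ _ : Unit => x) = ‖x‖

/-! ### Consequences of Ruan's axioms -/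

section Lemmas

/-- The scalar matrix which selects the rows of a matrix given by `e`. -/
def selMat {k m : Type} [DecidableEq m] (e : k → m) : Matrix k m ℂ :=
  fun i p => if p = e i then 1 else 0

lemma selMat_mul_conjTranspose {k m : Type} [Fintype m] [DecidableEq k] [DecidableEq m]
    {e : k → m} (he : Function.Injective e) :
    selMat e * (selMat e).conjTranspose = 1 := by
  ext i j
  simp [selMat, Matrix.mul_apply, Matrix.one_apply, he.eq_iff, eq_comm]

lemma norm_le_of_mul_conjTranspose {k m : Type} [Fintype k] [Fintype m] [DecidableEq k]
    [DecidableEq m] (α : Matrix k m ℂ) {c : ℝ} (hc : 0 ≤ c)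
    (h : α * α.conjTranspose = Matrix.diagonal fun _ => (c : ℂ)) : ‖α‖ ≤ √c := by
  have h1 := Matrix.l2_opNorm_conjTranspose_mul_self α.conjTranspose
  rw [Matrix.conjTranspose_conjTranspose, Matrix.l2_opNorm_conjTranspose, h,
    Matrix.l2_opNorm_diagonal] at h1
  have h2 : ‖(fun _ : k => (c : ℂ))‖ ≤ c := by
    refine (pi_norm_le_iff_of_nonneg hc).2 fun i => ?_
    simp [abs_of_nonneg hc]
  apply Real.le_sqrt_of_sq_le
  rw [sq, ← h1]
  exact h2

lemma norm_selMat_le {k m : Type} [Fintype k] [Fintype m] [DecidableEq m]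
    {e : k → m} (he : Function.Injective e) : ‖selMat e‖ ≤ 1 := by
  classical
  have := norm_le_of_mul_conjTranspose (selMat e) zero_le_one
    (by rw [selMat_mul_conjTranspose he]; ext i j; simp [Matrix.one_apply, Matrix.diagonal_apply])
  simpa using this

variable {V : Type*} [AddCommGroup V] [Module ℂ V] [RuanSpace V]
variable {k l m n : Type} [Fintype k] [Fintype l] [Fintype m] [Fintype n]

lemma mnorm_zero : mnorm (0 : Matrix m n V) = 0 := by
  classical
  have h1 := RuanSpace.mnorm_scalarMul_le (0 : Matrix m m ℂ) (0 : Matrix m n V)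
  have h2 : scalarMul (0 : Matrix m m ℂ) (0 : Matrix m n V) = 0 := by
    ext i j; simp [scalarMul]
  have h3 := RuanSpace.mnorm_add_le (0 : Matrix m n V) 0
  rw [h2, norm_zero, zero_mul] at h1
  rw [add_zero] at h3
  linarith

lemma mnorm_smul_le (c : ℂ) (x : Matrix m n V) : mnorm (c • x) ≤ ‖c‖ * mnorm x := by
  classical
  have h1 := RuanSpace.mnorm_scalarMul_le (Matrix.diagonal fun _ : m => c) x
  have h2 : scalarMul (Matrix.diagonal fun _ : m => c) x = c • x := by
    ext i j; simp [scalarMul, Matrix.diagonal_apply, ite_smul]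
  rw [h2, Matrix.l2_opNorm_diagonal] at h1
  rcases isEmpty_or_nonempty m with hm | hm
  · have : x = 0 := by ext i; exact hm.elim i
    simp [this, mnorm_zero]
  · simpa using h1

lemma mnorm_nonneg (x : Matrix m n V) : 0 ≤ mnorm x := by
  have h1 := RuanSpace.mnorm_add_le x ((-1 : ℂ) • x)
  have h2 := mnorm_smul_le (-1 : ℂ) x
  have h3 : x + (-1 : ℂ) • x = 0 := by ext i j; simp
  rw [h3, mnorm_zero] at h1
  simp only [norm_neg, norm_one, one_mul] at h2
  linarith

lemma mnorm_smul (c : ℂ) (x : Matrix m n V) : mnorm (c • x) = ‖c‖ * mnorm x := by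
  refine le_antisymm (mnorm_smul_le c x) ?_
  rcases eq_or_ne c 0 with rfl | hc
  · simp [mnorm_nonneg]
  · have h := mnorm_smul_le c⁻¹ (c • x)
    rw [inv_smul_smul₀ hc, norm_inv] at h
    have hc' : 0 < ‖c‖ := norm_pos_iff.2 hc
    calc ‖c‖ * mnorm x ≤ ‖c‖ * (‖c‖⁻¹ * mnorm (c • x)) := by gcongr
      _ = mnorm (c • x) := by field_simp

lemma mnorm_sub_comm (x y : Matrix m n V) : mnorm (x - y) = mnorm (y - x) := by
  have : x - y = (-1 : ℂ) • (y - x) := by ext i j; simp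
  rw [this, mnorm_smul]; simp

lemma mnorm_sum_le {ι : Type*} (s : Finset ι) (x : ι → Matrix m n V) :
    mnorm (∑ a ∈ s, x a) ≤ ∑ a ∈ s, mnorm (x a) := by
  classical
  induction s using Finset.induction_on with
  | empty => simp [mnorm_zero]
  | insert a s ha ih =>
    rw [Finset.sum_insert ha, Finset.sum_insert ha]
    exact (RuanSpace.mnorm_add_le _ _).trans (by gcongr)

lemma mnorm_submatrix_le (x : Matrix m n V) {e : k → m} {f : l → n}
    (he : Function.Injective e) (hf : Function.Injective f) :
    mnorm (x.submatrix e f) ≤ mnorm x := by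
  classical
  have h : x.submatrix e f = mulScalar (scalarMul (selMat e) x) (selMat f).conjTranspose := by
    ext i j
    simp [mulScalar, scalarMul, selMat, Matrix.conjTranspose_apply, ite_smul, apply_ite star]
  rw [h]
  calc _ ≤ mnorm (scalarMul (selMat e) x) * ‖(selMat f).conjTranspose‖ :=
        RuanSpace.mnorm_mulScalar_le _ _
    _ ≤ (‖selMat e‖ * mnorm x) * ‖(selMat f).conjTranspose‖ := by
        gcongr; exact RuanSpace.mnorm_scalarMul_le _ _
    _ ≤ (1 * mnorm x) * 1 := by
        have := mnorm_nonneg x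
        rw [Matrix.l2_opNorm_conjTranspose]
        gcongr
        · exact norm_selMat_le he
        · exact norm_selMat_le hf
    _ = mnorm x := by ring

/-- A matrix can be enlarged by zeros without changing its norm. -/
lemma mnorm_fromBlocks_zero (x : Matrix m n V) :
    mnorm (Matrix.fromBlocks 0 x (0 : Matrix n m V) 0) = mnorm x := by
  have h : Matrix.fromBlocks 0 x (0 : Matrix n m V) 0 =
      (Matrix.fromBlocks x 0 0 (0 : Matrix n m V)).submatrix id Sum.swap := by
    ext i j
    rcases i with i | i <;> rcases j with j | j <;> rfl
  have h' : Matrix.fromBlocks x 0 0 (0 : Matrix n m V) =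
      (Matrix.fromBlocks 0 x (0 : Matrix n m V) 0).submatrix id Sum.swap := by
    ext i j
    rcases i with i | i <;> rcases j with j | j <;> rfl
  have hs : Function.Injective (Sum.swap : n ⊕ m → m ⊕ n) := (Equiv.sumComm _ _).injective
  have hs' : Function.Injective (Sum.swap : m ⊕ n → n ⊕ m) := (Equiv.sumComm _ _).injective
  have e : mnorm (Matrix.fromBlocks x 0 0 (0 : Matrix n m V)) = mnorm x := by
    rw [RuanSpace.mnorm_fromBlocks, mnorm_zero, max_eq_left (mnorm_nonneg x)]
  refine le_antisymm ?_ ?_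
  · rw [h, ← e]; exact mnorm_submatrix_le _ Function.injective_id hs'
  · rw [← e, h']; exact mnorm_submatrix_le _ Function.injective_id hs

/-- The `1 × 1` matrix with entry `v`. -/
def unitMat (v : V) : Matrix Unit Unit V := fun _ _ => v

lemma mnorm_entry_le (x : Matrix m n V) (i : m) (j : n) : mnorm (unitMat (x i j)) ≤ mnorm x := by
  exact mnorm_submatrix_le x (e := fun _ : Unit => i) (f := fun _ : Unit => j)
    (fun _ _ _ => rfl) (fun _ _ _ => rfl)

lemma mnorm_le_sum (x : Matrix m n V) : mnorm x ≤ ∑ i, ∑ j, mnorm (unitMat (x i j)) := by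
  classical
  have h : x = ∑ i, ∑ j, mulScalar (scalarMul (selMat (fun _ : Unit => i)).conjTranspose
      (unitMat (x i j))) (selMat (fun _ : Unit => j)) := by
    ext a b
    simp [Matrix.sum_apply, mulScalar, scalarMul, selMat, Matrix.conjTranspose_apply, ite_smul,
      unitMat, apply_ite star]
  conv_lhs => rw [h]
  refine (mnorm_sum_le _ _).trans (Finset.sum_le_sum fun i _ => ?_)
  refine (mnorm_sum_le _ _).trans (Finset.sum_le_sum fun j _ => ?_)
  have hi : Function.Injective (fun _ : Unit => i) := fun _ _ _ => rfl
  have hj : Function.Injective (fun _ : Unit => j) := fun _ _ _ => rfl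
  calc _ ≤ mnorm (scalarMul (selMat (fun _ : Unit => i)).conjTranspose (unitMat (x i j)))
        * ‖selMat (fun _ : Unit => j)‖ := RuanSpace.mnorm_mulScalar_le _ _
    _ ≤ (‖(selMat (fun _ : Unit => i)).conjTranspose‖ * mnorm (unitMat (x i j)))
        * ‖selMat (fun _ : Unit => j)‖ := by
        gcongr; exact RuanSpace.mnorm_scalarMul_le _ _
    _ ≤ (1 * mnorm (unitMat (x i j))) * 1 := by
        have := mnorm_nonneg (unitMat (x i j))
        rw [Matrix.l2_opNorm_conjTranspose]
        gcongr
        · exact norm_selMat_le hi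
        · exact norm_selMat_le hj
    _ = _ := by ring

lemma mnorm_fromCols_le {p q : Type} [Fintype p] [Fintype q] (f : Matrix m p V)
    (g : Matrix m q V) {r s : ℝ} (hr : 0 < r) (hs : 0 < s) (hf : mnorm f ≤ √r)
    (hg : mnorm g ≤ √s) : mnorm (Matrix.fromCols f g) ≤ √(r + s) := by
  classical
  have hr' := Real.sqrt_pos.2 hr
  have hs' := Real.sqrt_pos.2 hs
  set α : Matrix m (m ⊕ m) ℂ := Matrix.fromCols (Matrix.diagonal fun _ => ((√r : ℝ) : ℂ))
    (Matrix.diagonal fun _ => ((√s : ℝ) : ℂ)) with hα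
  have hn : ‖α‖ ≤ √(r + s) := by
    apply norm_le_of_mul_conjTranspose _ (by positivity)
    ext i j
    simp only [hα, Matrix.conjTranspose_fromCols_eq_fromRows_conjTranspose,
      Matrix.fromCols_mul_fromRows, Matrix.diagonal_conjTranspose, Matrix.diagonal_mul_diagonal,
      Matrix.add_apply, Matrix.diagonal_apply]
    split_ifs with hij
    · simp only [Pi.star_apply, RCLike.star_def, Complex.conj_ofReal, ← Complex.ofReal_mul,
        ← Complex.ofReal_add, Real.mul_self_sqrt hr.le, Real.mul_self_sqrt hs.le]
    · simp
  have he : Matrix.fromCols f g = scalarMul α (Matrix.fromBlocks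
      ((((√r)⁻¹ : ℝ) : ℂ) • f) 0 0 ((((√s)⁻¹ : ℝ) : ℂ) • g)) := by
    ext i j
    have h1 : ((√r : ℝ) : ℂ) ≠ 0 := by exact_mod_cast hr'.ne'
    have h2 : ((√s : ℝ) : ℂ) ≠ 0 := by exact_mod_cast hs'.ne'
    rcases j with j | j <;>
      simp [scalarMul, hα, Matrix.diagonal_apply, ite_smul, smul_smul, h1, h2]
  rw [he]
  refine (RuanSpace.mnorm_scalarMul_le _ _).trans ?_
  rw [RuanSpace.mnorm_fromBlocks, mnorm_smul, mnorm_smul]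
  have h1 : ‖(((√r)⁻¹ : ℝ) : ℂ)‖ * mnorm f ≤ 1 := by
    rw [Complex.norm_real, Real.norm_of_nonneg (by positivity), inv_mul_le_iff₀ hr']
    simpa using hf
  have h2 : ‖(((√s)⁻¹ : ℝ) : ℂ)‖ * mnorm g ≤ 1 := by
    rw [Complex.norm_real, Real.norm_of_nonneg (by positivity), inv_mul_le_iff₀ hs']
    simpa using hg
  calc _ ≤ √(r + s) * 1 := by
        gcongr
        · exact le_max_of_le_left (mul_nonneg (norm_nonneg _) (mnorm_nonneg _))
        · exact max_le h1 h2
    _ = _ := mul_one _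

lemma mnorm_fromRows_le {p q : Type} [Fintype p] [Fintype q] (f : Matrix p n V)
    (g : Matrix q n V) {r s : ℝ} (hr : 0 < r) (hs : 0 < s) (hf : mnorm f ≤ √r)
    (hg : mnorm g ≤ √s) : mnorm (Matrix.fromRows f g) ≤ √(r + s) := by
  classical
  have hr' := Real.sqrt_pos.2 hr
  have hs' := Real.sqrt_pos.2 hs
  set α : Matrix n (n ⊕ n) ℂ := Matrix.fromCols (Matrix.diagonal fun _ => ((√r : ℝ) : ℂ))
    (Matrix.diagonal fun _ => ((√s : ℝ) : ℂ)) with hα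
  have hn : ‖α.conjTranspose‖ ≤ √(r + s) := by
    rw [Matrix.l2_opNorm_conjTranspose]
    apply norm_le_of_mul_conjTranspose _ (by positivity)
    ext i j
    simp only [hα, Matrix.conjTranspose_fromCols_eq_fromRows_conjTranspose,
      Matrix.fromCols_mul_fromRows, Matrix.diagonal_conjTranspose, Matrix.diagonal_mul_diagonal,
      Matrix.add_apply, Matrix.diagonal_apply]
    split_ifs with hij
    · simp only [Pi.star_apply, RCLike.star_def, Complex.conj_ofReal, ← Complex.ofReal_mul,
        ← Complex.ofReal_add, Real.mul_self_sqrt hr.le, Real.mul_self_sqrt hs.le]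
    · simp
  have he : Matrix.fromRows f g = mulScalar (Matrix.fromBlocks
      ((((√r)⁻¹ : ℝ) : ℂ) • f) 0 0 ((((√s)⁻¹ : ℝ) : ℂ) • g)) α.conjTranspose := by
    ext j i
    have h1 : ((√r : ℝ) : ℂ) ≠ 0 := by exact_mod_cast hr'.ne'
    have h2 : ((√s : ℝ) : ℂ) ≠ 0 := by exact_mod_cast hs'.ne'
    rcases j with j | j <;>
      simp [mulScalar, hα, Matrix.diagonal_apply, ite_smul, smul_smul, h1, h2,
        Matrix.conjTranspose_apply, apply_ite (starRingEnd ℂ)]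
  rw [he]
  refine (RuanSpace.mnorm_mulScalar_le _ _).trans ?_
  rw [RuanSpace.mnorm_fromBlocks, mnorm_smul, mnorm_smul]
  have h1 : ‖(((√r)⁻¹ : ℝ) : ℂ)‖ * mnorm f ≤ 1 := by
    rw [Complex.norm_real, Real.norm_of_nonneg (by positivity), inv_mul_le_iff₀ hr']
    simpa using hf
  have h2 : ‖(((√s)⁻¹ : ℝ) : ℂ)‖ * mnorm g ≤ 1 := by
    rw [Complex.norm_real, Real.norm_of_nonneg (by positivity), inv_mul_le_iff₀ hs']
    simpa using hg
  calc _ ≤ 1 * √(r + s) := by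
        gcongr
        exact max_le h1 h2
    _ = _ := one_mul _

end Lemmas

/-! ### Concrete operator spaces -/

section Concrete

set_option linter.unusedSectionVars false

variable {H : Type*} [NormedAddCommGroup H] [InnerProductSpace ℂ H]
variable {k l m n : Type} [Fintype k] [Fintype l] [Fintype m] [Fintype n]

/-- A matrix of operators on `H` as an operator `H^n → H^m`. -/
def opMat (T : Matrix m n (H →L[ℂ] H)) :
    PiLp 2 (fun _ : n => H) →L[ℂ] PiLp 2 (fun _ : m => H) :=
  (PiLp.continuousLinearEquiv 2 ℂ fun _ : m => H).symm.toContinuousLinearMap ∘L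
    ContinuousLinearMap.pi fun i => ∑ j, (T i j).comp (PiLp.proj 2 (fun _ : n => H) j)

lemma opMat_apply (T : Matrix m n (H →L[ℂ] H)) (v : PiLp 2 (fun _ : n => H)) (i : m) :
    opMat T v i = ∑ j, T i j (v j) := by
  simp [opMat]

lemma norm_sq_opMat (T : Matrix m n (H →L[ℂ] H)) (v : PiLp 2 (fun _ : n => H)) :
    ‖opMat T v‖ ^ 2 = ∑ i, ‖∑ j, T i j (v j)‖ ^ 2 := by
  rw [PiLp.norm_sq_eq_of_L2]
  simp [opMat_apply]

lemma opMat_add (S T : Matrix m n (H →L[ℂ] H)) : opMat (S + T) = opMat S + opMat T := by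
  ext v i
  simp [opMat_apply, Finset.sum_add_distrib]

/-- Scalar matrices act with their operator norm on tuples of vectors of a Hilbert space. -/
lemma sum_norm_sq_scalar_le [DecidableEq n] (α : Matrix m n ℂ) (v : n → H) :
    ∑ i, ‖∑ j, α i j • v j‖ ^ 2 ≤ ‖α‖ ^ 2 * ∑ j, ‖v j‖ ^ 2 := by
  let S : Submodule ℂ H := Submodule.span ℂ (Set.range v)
  have : FiniteDimensional ℂ S := FiniteDimensional.span_of_finite ℂ (Set.finite_range v)
  let b := stdOrthonormalBasis ℂ S
  let w : n → S := fun j => ⟨v j, Submodule.subset_span ⟨j, rfl⟩⟩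
  have h1 (i : m) : ‖∑ j, α i j • v j‖ ^ 2 = ∑ e, ‖∑ j, α i j * inner ℂ (b e) (w j)‖ ^ 2 := by
    have e : ‖∑ j, α i j • v j‖ = ‖∑ j, α i j • w j‖ := by
      have e' : ∑ j, α i j • v j = ((∑ j, α i j • w j : S) : H) := by simp [w]
      exact (congrArg norm e').trans (Submodule.norm_coe _)
    rw [e, ← b.sum_sq_norm_inner_right]
    simp [inner_sum, inner_smul_right]
  have h2 (j : n) : ‖v j‖ ^ 2 = ∑ e, ‖(inner ℂ (b e) (w j) : ℂ)‖ ^ 2 := by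
    rw [b.sum_sq_norm_inner_right]; rfl
  simp_rw [h1, h2]
  rw [Finset.sum_comm, Finset.sum_comm (s := (Finset.univ : Finset n)), Finset.mul_sum]
  refine Finset.sum_le_sum fun e _ => ?_
  have h := Matrix.l2_opNorm_mulVec α (WithLp.toLp 2 fun j => (inner ℂ (b e) (w j) : ℂ))
  have h' := pow_le_pow_left₀ (norm_nonneg _) h 2
  rw [mul_pow, EuclideanSpace.norm_sq_eq, EuclideanSpace.norm_sq_eq] at h'
  exact h'

lemma norm_opMat_le {T : Matrix m n (H →L[ℂ] H)} {C : ℝ} (hC : 0 ≤ C)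
    (h : ∀ v : n → H, ∑ i, ‖∑ j, T i j (v j)‖ ^ 2 ≤ C ^ 2 * ∑ j, ‖v j‖ ^ 2) : ‖opMat T‖ ≤ C := by
  refine ContinuousLinearMap.opNorm_le_bound _ hC fun v => ?_
  refine (sq_le_sq₀ (norm_nonneg _) (by positivity)).1 ?_
  rw [norm_sq_opMat, mul_pow, PiLp.norm_sq_eq_of_L2]
  exact h v

lemma sum_norm_sq_opMat_le (T : Matrix m n (H →L[ℂ] H)) (v : n → H) :
    ∑ i, ‖∑ j, T i j (v j)‖ ^ 2 ≤ ‖opMat T‖ ^ 2 * ∑ j, ‖v j‖ ^ 2 := by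
  have h := pow_le_pow_left₀ (norm_nonneg _) ((opMat T).le_opNorm (WithLp.toLp 2 v)) 2
  rw [norm_sq_opMat, mul_pow, PiLp.norm_sq_eq_of_L2] at h
  exact h

/-- A norm closed linear space of bounded operators on a Hilbert space `H`, given as the range of
an isometry `J`, is an operator space for the operator norms of `M_{m,n}(B(H)) = B(H^n, H^m)`. -/
abbrev OperatorSpace.ofIsometry {X : Type*} [NormedAddCommGroup X] [NormedSpace ℂ X]
    [CompleteSpace X] (J : X →ₗᵢ[ℂ] H →L[ℂ] H) : OperatorSpace X where
  mnorm x := ‖opMat (x.map J)‖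
  mnorm_add_le x y := by
    have h : (x + y).map J = x.map J + y.map J := by ext1 i j; simp
    rw [h, opMat_add]
    exact ContinuousLinearMap.opNorm_add_le _ _
  mnorm_scalarMul_le α x := by
    refine norm_opMat_le (by positivity) fun v => ?_
    have h (i) : ∑ j, ((scalarMul α x).map J) i j (v j) =
        ∑ p, α i p • ∑ j, (x.map J) p j (v j) := by
      simp only [scalarMul, Matrix.map_apply, map_sum, map_smul, _root_.sum_apply,
        _root_.smul_apply, Finset.smul_sum]
      exact Finset.sum_comm
    simp_rw [h]
    refine (sum_norm_sq_scalar_le α _).trans ?_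
    rw [mul_pow, mul_assoc]
    exact mul_le_mul_of_nonneg_left (sum_norm_sq_opMat_le _ v) (by positivity)
  mnorm_mulScalar_le x β := by
    refine norm_opMat_le (by positivity) fun v => ?_
    have h (i) : ∑ j, ((mulScalar x β).map J) i j (v j) =
        ∑ q, (x.map J) i q (∑ j, β q j • v j) := by
      simp only [mulScalar, Matrix.map_apply, map_sum, map_smul, _root_.sum_apply,
        _root_.smul_apply]
      exact Finset.sum_comm
    simp_rw [h]
    refine (sum_norm_sq_opMat_le _ _).trans ?_
    rw [mul_pow, mul_assoc]
    exact mul_le_mul_of_nonneg_left (sum_norm_sq_scalar_le β v) (by positivity)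
  mnorm_fromBlocks x y := by
    refine le_antisymm (norm_opMat_le (by positivity) fun v => ?_) (max_le ?_ ?_)
    · simp only [Fintype.sum_sum_type, Matrix.map_apply, Matrix.fromBlocks_apply₁₁,
        Matrix.fromBlocks_apply₁₂, Matrix.fromBlocks_apply₂₁, Matrix.fromBlocks_apply₂₂,
        Matrix.zero_apply, map_zero, _root_.zero_apply, Finset.sum_const_zero,
        add_zero, zero_add, mul_add]
      refine add_le_add ((sum_norm_sq_opMat_le (x.map J) fun j => v (Sum.inl j)).trans ?_)
        ((sum_norm_sq_opMat_le (y.map J) fun j => v (Sum.inr j)).trans ?_)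
      · gcongr
        exact le_max_left _ _
      · gcongr
        exact le_max_right _ _
    · refine norm_opMat_le (ContinuousLinearMap.opNorm_nonneg _) fun v => ?_
      have h := sum_norm_sq_opMat_le ((Matrix.fromBlocks x 0 0 y).map J) (Sum.elim v 0)
      simpa [Fintype.sum_sum_type] using h
    · refine norm_opMat_le (ContinuousLinearMap.opNorm_nonneg _) fun v => ?_
      have h := sum_norm_sq_opMat_le ((Matrix.fromBlocks x 0 0 y).map J) (Sum.elim 0 v)
      simpa [Fintype.sum_sum_type] using h
  mnorm_one_one x := by
    rw [← J.norm_map]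
    refine le_antisymm (norm_opMat_le (ContinuousLinearMap.opNorm_nonneg _) fun v => ?_)
      (ContinuousLinearMap.opNorm_le_bound _ (ContinuousLinearMap.opNorm_nonneg _) fun v => ?_)
    · simp only [Finset.univ_unique, Finset.sum_singleton, ← mul_pow]
      gcongr
      exact (J x).le_opNorm _
    · have h := sum_norm_sq_opMat_le (Matrix.map (fun _ _ : Unit => x) J) fun _ => v
      simp only [Finset.univ_unique, Finset.sum_singleton, ← mul_pow] at h
      exact (sq_le_sq₀ (by positivity) (by positivity)).1 h

end Concrete

/-! ### Completely bounded maps -/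

section CompletelyBounded

variable {X Y : Type*} [AddCommGroup X] [Module ℂ X] [AddCommGroup Y] [Module ℂ Y]

/-- The amplification of a matrix `t = [t i j]` of linear maps `X → Y`, that is, of a linear map
`X → M_{m,n}(Y)`, to a map `M_k(X) → M_k(M_{m,n}(Y)) = M_{mk,nk}(Y)`. -/
def amplify {m n k l : Type} (t : Matrix m n (X →ₗ[ℂ] Y)) (x : Matrix k l X) :
    Matrix (m × k) (n × l) Y :=
  fun a b => t a.1 b.1 (x a.2 b.2)

/-- `C` is a bound for all the amplifications `t_k : M_k(X) → M_k(Y)` of the linear map `t`. -/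
def IsCBBound [MatrixNorms X] [MatrixNorms Y] (t : X →ₗ[ℂ] Y) (C : ℝ) : Prop :=
  ∀ {k : Type} [Fintype k] (x : Matrix k k X), mnorm (x.map t) ≤ C * mnorm x

/-- A linear map is completely bounded if its amplifications are uniformly bounded. -/
def IsCompletelyBounded [MatrixNorms X] [MatrixNorms Y] (t : X →ₗ[ℂ] Y) : Prop :=
  ∃ C : ℝ, 0 ≤ C ∧ IsCBBound t C

/-- A linear map is completely contractive if its amplifications are contractive. -/
def IsCompletelyContractive [MatrixNorms X] [MatrixNorms Y] (t : X →ₗ[ℂ] Y) : Prop :=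
  IsCBBound t 1

/-- The completely bounded norm of a matrix of linear maps `X → Y`, considered as a linear map
`X → M_{m,n}(Y)`. -/
def cbNorm [MatrixNorms X] [MatrixNorms Y] {m n : Type} [Fintype m] [Fintype n]
    (t : Matrix m n (X →ₗ[ℂ] Y)) : ℝ :=
  sInf {C : ℝ | 0 ≤ C ∧ ∀ {k : Type} [Fintype k] (x : Matrix k k X),
    mnorm (amplify t x) ≤ C * mnorm x}

/-- A bound for a linear map on square matrices is also a bound on rectangular matrices. -/
lemma IsCBBound.rect [RuanSpace X] [RuanSpace Y] {t : X →ₗ[ℂ] Y} {C : ℝ} (h : IsCBBound t C)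
    {k l : Type} [Fintype k] [Fintype l] (x : Matrix k l X) :
    mnorm (x.map t) ≤ C * mnorm x := by
  have h1 := h (Matrix.fromBlocks 0 x (0 : Matrix l k X) 0)
  have h2 : (Matrix.fromBlocks 0 x (0 : Matrix l k X) 0).map t =
      Matrix.fromBlocks 0 (x.map t) (0 : Matrix l k Y) 0 := by
    rw [Matrix.fromBlocks_map]
    simp
  rwa [h2, mnorm_fromBlocks_zero, mnorm_fromBlocks_zero] at h1

end CompletelyBounded

/-! ### Operator modules -/

section Modules

/-- The norm of the `C⋆`-algebra `M_n(A)`. -/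
def cstarMatrixNorm {A : Type*} [NonUnitalCStarAlgebra A] {n : Type} [Fintype n]
    (a : Matrix n n A) : ℝ :=
  letI := CStarAlgebra.spectralOrder A
  haveI := CStarAlgebra.spectralOrderedRing A
  ‖CStarMatrix.ofMatrix a‖

/-- A left operator module over a `C⋆`-algebra `A`: an operator space `X` with an action of `A`
(not assumed to be nondegenerate) such that `‖a x‖ ≤ ‖a‖ ‖x‖` for all `a ∈ M_n(A)` and
`x ∈ M_n(X)`. -/
class LeftOperatorModule (A X : Type*) [NonUnitalCStarAlgebra A] [NormedAddCommGroup X]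
    [NormedSpace ℂ X] [OperatorSpace X] where
  /-- the left action, `lact a x = a x` -/
  lact : A →ₗ[ℂ] X →ₗ[ℂ] X
  lact_mul : ∀ (a b : A) (x : X), lact (a * b) x = lact a (lact b x)
  mnorm_lact_le : ∀ {n : Type} [Fintype n] (a : Matrix n n A) (x : Matrix n n X),
    mnorm (fun i j => ∑ k, lact (a i k) (x k j)) ≤ cstarMatrixNorm a * mnorm x

/-- A right operator module over a `C⋆`-algebra `B`. -/
class RightOperatorModule (B F : Type*) [NonUnitalCStarAlgebra B] [NormedAddCommGroup F]
    [NormedSpace ℂ F] [OperatorSpace F] where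
  /-- the right action, `ract b f = f b` -/
  ract : B →ₗ[ℂ] F →ₗ[ℂ] F
  ract_mul : ∀ (b c : B) (f : F), ract (b * c) f = ract c (ract b f)
  mnorm_ract_le : ∀ {n : Type} [Fintype n] (f : Matrix n n F) (b : Matrix n n B),
    mnorm (fun i j => ∑ k, ract (b k j) (f i k)) ≤ mnorm f * cstarMatrixNorm b

open LeftOperatorModule RightOperatorModule

/-- An operator `A`-`B`-bimodule. -/
class OperatorBimodule (A B F : Type*) [NonUnitalCStarAlgebra A] [NonUnitalCStarAlgebra B]
    [NormedAddCommGroup F] [NormedSpace ℂ F] [OperatorSpace F] extends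
    LeftOperatorModule A F, RightOperatorModule B F where
  lact_ract : ∀ (a : A) (b : B) (f : F), lact a (ract b f) = ract b (lact a f)

section Left

variable {A : Type*} [NonUnitalCStarAlgebra A]
  {X : Type*} [NormedAddCommGroup X] [NormedSpace ℂ X] [OperatorSpace X] [LeftOperatorModule A X]

/-- The product of a matrix over `A` and a matrix over a left `A`-module. -/
def lmul {k m n : Type} [Fintype m] (a : Matrix k m A) (x : Matrix m n X) : Matrix k n X :=
  fun i j => ∑ p, lact (a i p) (x p j)

lemma cstarMatrixNorm_nonneg {n : Type} [Fintype n] (a : Matrix n n A) :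
    0 ≤ cstarMatrixNorm a := by
  let _ := CStarAlgebra.spectralOrder A
  have _ := CStarAlgebra.spectralOrderedRing A
  exact norm_nonneg (CStarMatrix.ofMatrix a)

lemma cstarMatrixNorm_fromBlocks_le {m n : Type} [Fintype m] [Fintype n] (a : Matrix m m A) :
    cstarMatrixNorm (Matrix.fromBlocks a 0 0 (0 : Matrix n n A)) ≤ cstarMatrixNorm a := by
  let _ := CStarAlgebra.spectralOrder A
  have _ := CStarAlgebra.spectralOrderedRing A
  let blk : Matrix m m A → Matrix (m ⊕ n) (m ⊕ n) A := fun a => Matrix.fromBlocks a 0 0 0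
  have hsmul (c : ℂ) (a : Matrix m m A) : blk (c • a) = c • blk a := by
    simp [blk, Matrix.fromBlocks_smul]
  have hzero : blk 0 = 0 := by simp [blk]
  have hadd (a b : Matrix m m A) : blk (a + b) = blk a + blk b := by
    simp [blk, Matrix.fromBlocks_add]
  have hmul (a b : Matrix m m A) : blk (a * b) = blk a * blk b := by
    simp [blk, Matrix.fromBlocks_multiply]
  have hstar (a : Matrix m m A) : blk a.conjTranspose = (blk a).conjTranspose := by
    simp [blk, Matrix.fromBlocks_conjTranspose]
  let φ : CStarMatrix m m A →⋆ₙₐ[ℂ] CStarMatrix (m ⊕ n) (m ⊕ n) A :=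
    { toFun := fun a => CStarMatrix.ofMatrix (blk (CStarMatrix.ofMatrix.symm a))
      map_smul' := hsmul
      map_zero' := hzero
      map_add' := hadd
      map_mul' := hmul
      map_star' := hstar }
  exact NonUnitalStarAlgHom.norm_apply_le φ (CStarMatrix.ofMatrix a)

/-- The module inequality for rectangular matrices. -/
lemma mnorm_lmul_le {m n : Type} [Fintype m] [Fintype n] (a : Matrix m m A) (x : Matrix m n X) :
    mnorm (lmul a x) ≤ cstarMatrixNorm a * mnorm x := by
  have h := mnorm_lact_le (Matrix.fromBlocks a 0 0 (0 : Matrix n n A))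
    (Matrix.fromBlocks 0 x (0 : Matrix n m X) 0)
  have h2 : (fun i j => ∑ k, lact (Matrix.fromBlocks a 0 0 (0 : Matrix n n A) i k)
      (Matrix.fromBlocks 0 x (0 : Matrix n m X) 0 k j)) =
      Matrix.fromBlocks 0 (lmul a x) (0 : Matrix n m X) 0 := by
    ext i j
    rcases i with i | i <;> rcases j with j | j <;> simp [lmul]
  rw [h2, mnorm_fromBlocks_zero, mnorm_fromBlocks_zero] at h
  exact h.trans (mul_le_mul_of_nonneg_right (cstarMatrixNorm_fromBlocks_le a) (mnorm_nonneg x))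

end Left

/-- The space `CB_A(X, Y)` of completely bounded `A`-linear maps. -/
def CBMod (A X Y : Type*) [NonUnitalCStarAlgebra A]
    [NormedAddCommGroup X] [NormedSpace ℂ X] [OperatorSpace X] [LeftOperatorModule A X]
    [NormedAddCommGroup Y] [NormedSpace ℂ Y] [OperatorSpace Y] [LeftOperatorModule A Y] :
    Submodule ℂ (X →ₗ[ℂ] Y) where
  carrier := {t | IsCompletelyBounded t ∧ ∀ (a : A) (x : X), t (lact a x) = lact a (t x)}
  add_mem' := by
    rintro s t ⟨⟨C, hC, hs⟩, hs'⟩ ⟨⟨D, hD, ht⟩, ht'⟩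
    refine ⟨⟨C + D, by positivity, fun x => ?_⟩, fun a x => by simp [hs', ht']⟩
    have : x.map (s + t) = x.map s + x.map t := by ext i j; simp
    rw [this, add_mul]
    exact (RuanSpace.mnorm_add_le _ _).trans (add_le_add (hs x) (ht x))
  zero_mem' := by
    refine ⟨⟨0, le_rfl, fun x => ?_⟩, fun a x => by simp⟩
    have : x.map (0 : X →ₗ[ℂ] Y) = 0 := by ext i j; simp
    rw [this, mnorm_zero, zero_mul]
  smul_mem' := by
    rintro c t ⟨⟨D, hD, ht⟩, ht'⟩
    refine ⟨⟨‖c‖ * D, by positivity, fun x => ?_⟩, fun a x => by simp [ht']⟩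
    have : x.map (c • t) = c • x.map t := by ext i j; simp
    rw [this, mnorm_smul, mul_assoc]
    exact mul_le_mul_of_nonneg_left (ht x) (norm_nonneg c)

/-- The matrix norms of the operator space `CB_A(X, Y)`: a matrix `[t i j]` of maps `X → Y` has the
completely bounded norm of the corresponding map `X → M_{m,n}(Y)`. -/
instance (A X Y : Type*) [NonUnitalCStarAlgebra A]
    [NormedAddCommGroup X] [NormedSpace ℂ X] [OperatorSpace X] [LeftOperatorModule A X]
    [NormedAddCommGroup Y] [NormedSpace ℂ Y] [OperatorSpace Y] [LeftOperatorModule A Y] :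
    MatrixNorms (CBMod A X Y) where
  mnorm t := cbNorm fun i j => (t i j : X →ₗ[ℂ] Y)

end Modules

/-! ### Completion -/

section Completion

open UniformSpace

/-- The norm of a seminormed space is the norm of its `1 × 1` matrices. -/
class CompatibleNorm (V : Type*) [SeminormedAddCommGroup V] [NormedSpace ℂ V] [RuanSpace V] :
    Prop where
  mnorm_unitMat : ∀ v : V, mnorm (unitMat v) = ‖v‖

instance (X : Type*) [NormedAddCommGroup X] [NormedSpace ℂ X] [OperatorSpace X] :
    CompatibleNorm X := ⟨OperatorSpace.mnorm_one_one⟩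

variable {V : Type*} [SeminormedAddCommGroup V] [NormedSpace ℂ V] [RuanSpace V]
  [CompatibleNorm V]
variable {k l m n : Type} [Fintype k] [Fintype l] [Fintype m] [Fintype n]

set_option linter.unusedSectionVars false

/-- The entrywise embedding of `M_{m,n}(V)` in `M_{m,n}(V̂)`. -/
def matCoe (u : Matrix m n V) : Matrix m n (Completion V) := u.map (↑)

lemma isUniformInducing_matCoe :
    IsUniformInducing (matCoe : Matrix m n V → Matrix m n (Completion V)) :=
  Isometry.isUniformInducing (α := m → n → V) (β := m → n → Completion V)
    (Isometry.piMap _ fun _ => Isometry.piMap _ fun _ => Completion.coe_isometry)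

lemma denseRange_matCoe :
    DenseRange (matCoe : Matrix m n V → Matrix m n (Completion V)) :=
  DenseRange.piMap (X := fun _ : m => n → V) (Y := fun _ : m => n → Completion V) fun _ =>
    DenseRange.piMap (X := fun _ : n => V) (Y := fun _ : n => Completion V) fun _ =>
      Completion.denseRange_coe

lemma isDenseInducing_matCoe :
    IsDenseInducing (matCoe : Matrix m n V → Matrix m n (Completion V)) :=
  isUniformInducing_matCoe.isDenseInducing denseRange_matCoe

lemma abs_mnorm_sub_le (u v : Matrix m n V) : |mnorm u - mnorm v| ≤ mnorm (u - v) := by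
  have h1 := RuanSpace.mnorm_add_le (u - v) v
  have h2 := RuanSpace.mnorm_add_le (v - u) u
  rw [mnorm_sub_comm v u] at h2
  rw [sub_add_cancel] at h1 h2
  rw [abs_le]
  constructor <;> linarith

lemma uniformContinuous_mnorm :
    UniformContinuous (mnorm : Matrix m n V → ℝ) := by
  have h : ∀ u v : m → n → V, dist (mnorm (m := m) (n := n) u) (mnorm (m := m) (n := n) v) ≤
      ((Fintype.card m * Fintype.card n : ℕ) : NNReal) * dist u v := by
    intro u v
    rw [Real.dist_eq]
    refine (abs_mnorm_sub_le (m := m) (n := n) u v).trans ?_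
    refine (mnorm_le_sum _).trans ?_
    calc ∑ i : m, ∑ j : n, mnorm (unitMat (u i j - v i j))
        ≤ ∑ i : m, ∑ j : n, dist u v := by
          gcongr with i _ j _
          rw [CompatibleNorm.mnorm_unitMat, ← dist_eq_norm]
          exact (dist_le_pi_dist (u i) (v i) j).trans (dist_le_pi_dist u v i)
      _ = _ := by simp [mul_assoc]
  exact (LipschitzWith.of_dist_le_mul h).uniformContinuous

/-- The matrix norms on the (Hausdorff) completion of `V`, extended by continuity. -/
instance : MatrixNorms (Completion V) where
  mnorm := (isDenseInducing_matCoe (V := V)).extend mnorm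

lemma mnorm_matCoe (u : Matrix m n V) : mnorm (matCoe u) = mnorm u :=
  (isDenseInducing_matCoe (V := V)).extend_eq uniformContinuous_mnorm.continuous u

lemma continuous_mnorm_completion :
    Continuous (mnorm : Matrix m n (Completion V) → ℝ) :=
  (uniformContinuous_uniformly_extend isUniformInducing_matCoe denseRange_matCoe
    uniformContinuous_mnorm).continuous

lemma matCoe_induction {P : Matrix m n (Completion V) → Prop} (z : Matrix m n (Completion V))
    (hP : IsClosed {z | P z}) (h : ∀ u : Matrix m n V, P (matCoe u)) : P z :=
  denseRange_matCoe.induction_on z hP h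

lemma continuous_scalarMul (α : Matrix k m ℂ) :
    Continuous (scalarMul α : Matrix m n (Completion V) → Matrix k n (Completion V)) := by
  refine continuous_pi fun i => continuous_pi fun j => ?_
  exact continuous_finsetSum _ fun p _ => Continuous.const_smul
    (g := fun z : Matrix m n (Completion V) => z p j)
    (continuous_apply_apply p j) (α i p)

lemma continuous_mulScalar (β : Matrix n l ℂ) :
    Continuous (fun z : Matrix m n (Completion V) => mulScalar z β) := by
  refine continuous_pi fun i => continuous_pi fun j => ?_
  exact continuous_finsetSum _ fun q _ => Continuous.const_smul
    (g := fun z : Matrix m n (Completion V) => z i q)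
    (continuous_apply_apply i q) (β q j)

instance : RuanSpace (Completion V) where
  mnorm_add_le x y := by
    refine matCoe_induction (P := fun x => mnorm (x + y) ≤ mnorm x + mnorm y) x ?_ fun u =>
      matCoe_induction (P := fun y => mnorm (matCoe u + y) ≤ mnorm (matCoe u) + mnorm y) y ?_ fun v => ?_
    · exact isClosed_le (continuous_mnorm_completion.comp (continuous_id.add continuous_const))
        (continuous_mnorm_completion.add continuous_const)
    · exact isClosed_le (continuous_mnorm_completion.comp (continuous_const.add continuous_id))
        (continuous_const.add continuous_mnorm_completion)
    · have h : matCoe u + matCoe v = matCoe (u + v) := by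
        ext i j; simp [matCoe, Completion.coe_add]
      rw [h, mnorm_matCoe, mnorm_matCoe, mnorm_matCoe]
      exact RuanSpace.mnorm_add_le u v
  mnorm_scalarMul_le α x := by
    refine matCoe_induction (P := fun x => mnorm (scalarMul α x) ≤ ‖α‖ * mnorm x) x ?_ fun u => ?_
    · exact isClosed_le (continuous_mnorm_completion.comp (continuous_scalarMul α))
        (continuous_const.mul continuous_mnorm_completion)
    · have h : scalarMul α (matCoe u) = matCoe (scalarMul α u) := by
        ext i j
        simp only [matCoe, scalarMul, Matrix.map_apply, ← Completion.coe_smul]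
        exact (map_sum (Completion.toComplL (𝕜 := ℂ) (E := V)) _ _).symm
      rw [h, mnorm_matCoe, mnorm_matCoe]
      exact RuanSpace.mnorm_scalarMul_le α u
  mnorm_mulScalar_le x β := by
    refine matCoe_induction (P := fun x => mnorm (mulScalar x β) ≤ mnorm x * ‖β‖) x ?_ fun u => ?_
    · exact isClosed_le (continuous_mnorm_completion.comp (continuous_mulScalar β))
        (continuous_mnorm_completion.mul continuous_const)
    · have h : mulScalar (matCoe u) β = matCoe (mulScalar u β) := by
        ext i j
        simp only [matCoe, mulScalar, Matrix.map_apply, ← Completion.coe_smul]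
        exact (map_sum (Completion.toComplL (𝕜 := ℂ) (E := V)) _ _).symm
      rw [h, mnorm_matCoe, mnorm_matCoe]
      exact RuanSpace.mnorm_mulScalar_le u β
  mnorm_fromBlocks x y := by
    refine matCoe_induction (P := fun x => mnorm (Matrix.fromBlocks x 0 0 y) = max (mnorm x) (mnorm y)) x ?_ fun u =>
      matCoe_induction (P := fun y => mnorm (Matrix.fromBlocks (matCoe u) 0 0 y) = max (mnorm (matCoe u)) (mnorm y)) y ?_ fun v => ?_
    · exact isClosed_eq (continuous_mnorm_completion.comp
        (Continuous.matrix_fromBlocks continuous_id continuous_const continuous_const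
          continuous_const)) (continuous_mnorm_completion.max continuous_const)
    · exact isClosed_eq (continuous_mnorm_completion.comp
        (Continuous.matrix_fromBlocks continuous_const continuous_const continuous_const
          continuous_id)) (continuous_const.max continuous_mnorm_completion)
    · have h : Matrix.fromBlocks (matCoe u) 0 0 (matCoe v) = matCoe (Matrix.fromBlocks u 0 0 v) := by
        ext i j
        rcases i with i | i <;> rcases j with j | j <;> simp [matCoe, Completion.coe_zero]
      rw [h, mnorm_matCoe, mnorm_matCoe, mnorm_matCoe]
      exact RuanSpace.mnorm_fromBlocks u v

instance : OperatorSpace (Completion V) where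
  mnorm_one_one x := by
    induction x using Completion.induction_on with
    | hp =>
      refine isClosed_eq (continuous_mnorm_completion.comp (continuous_pi fun _ =>
        continuous_pi fun _ => continuous_id)) continuous_norm
    | ih v =>
      rw [Completion.norm_coe, ← CompatibleNorm.mnorm_unitMat v, ← mnorm_matCoe]
      rfl

/-- A bound of the amplifications of a linear map persists on the completion. -/
lemma mnorm_map_completion_le {W : Type*} [SeminormedAddCommGroup W] [NormedSpace ℂ W]
    [RuanSpace W] [CompatibleNorm W] (t : V →L[ℂ] W) {C : ℝ}
    (h : ∀ u : Matrix m n V, mnorm (u.map t) ≤ C * mnorm u) (z : Matrix m n (Completion V)) :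
    mnorm (z.map t.completion) ≤ C * mnorm z := by
  refine matCoe_induction (P := fun z => mnorm (z.map t.completion) ≤ C * mnorm z) z ?_ fun u => ?_
  · exact isClosed_le (continuous_mnorm_completion.comp
      (Continuous.matrix_map continuous_id t.completion.continuous))
      (continuous_const.mul continuous_mnorm_completion)
  · have e : (matCoe u).map t.completion = matCoe (u.map t) := by
      ext i j; simp [matCoe]
    rw [e, mnorm_matCoe, mnorm_matCoe]
    exact h u

section

variable {U W : Type*} [SeminormedAddCommGroup U] [NormedSpace ℂ U]
  [SeminormedAddCommGroup W] [NormedSpace ℂ W]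

lemma completion_add (S T : U →L[ℂ] W) : (S + T).completion = S.completion + T.completion := by
  ext z
  induction z using Completion.induction_on with
  | hp =>
    exact isClosed_eq (ContinuousLinearMap.continuous _)
      ((ContinuousLinearMap.continuous _).add (ContinuousLinearMap.continuous _))
  | ih u => simp [Completion.coe_add]

lemma completion_smul (c : ℂ) (T : U →L[ℂ] W) : (c • T).completion = c • T.completion := by
  ext z
  induction z using Completion.induction_on with
  | hp =>
    exact isClosed_eq (ContinuousLinearMap.continuous _)
      ((ContinuousLinearMap.continuous _).const_smul c)
  | ih u => simp [Completion.coe_smul]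

lemma completion_comp_apply {Z : Type*} [SeminormedAddCommGroup Z] [NormedSpace ℂ Z]
    (S : W →L[ℂ] Z) (T : U →L[ℂ] W) (z : Completion U) :
    (S.comp T).completion z = S.completion (T.completion z) := by
  induction z using Completion.induction_on with
  | hp =>
    exact isClosed_eq (ContinuousLinearMap.continuous _)
      ((ContinuousLinearMap.continuous _).comp (ContinuousLinearMap.continuous _))
  | ih u => simp

end

/-- A bound of the action of a matrix of linear maps persists on the completion. -/
lemma mnorm_sum_completion_le (T : Matrix m m (V →L[ℂ] V)) {C : ℝ}
    (h : ∀ u : Matrix m n V, mnorm (fun i j => ∑ k, T i k (u k j) : Matrix m n V) ≤ C * mnorm u)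
    (z : Matrix m n (Completion V)) :
    mnorm (fun i j => ∑ k, (T i k).completion (z k j) : Matrix m n (Completion V)) ≤
      C * mnorm z := by
  refine matCoe_induction (P := fun z => mnorm (fun i j => ∑ k, (T i k).completion (z k j) :
    Matrix m n (Completion V)) ≤ C * mnorm z) z ?_ fun u => ?_
  · refine isClosed_le (continuous_mnorm_completion.comp ?_)
      (continuous_const.mul continuous_mnorm_completion)
    refine continuous_pi fun i => continuous_pi fun j => ?_
    exact continuous_finsetSum _ fun k _ =>
      (ContinuousLinearMap.continuous _).comp (continuous_apply_apply k j)
  · have e : (fun i j => ∑ k, (T i k).completion (matCoe u k j) : Matrix m n (Completion V)) =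
        matCoe (fun i j => ∑ k, T i k (u k j) : Matrix m n V) := by
      ext i j
      simp only [matCoe, Matrix.map_apply, ContinuousLinearMap.completion_apply_coe]
      exact (map_sum (Completion.toComplL (𝕜 := ℂ) (E := V)) _ _).symm
    rw [e]
    exact ((mnorm_matCoe _).le.trans (h u)).trans_eq (by rw [mnorm_matCoe u])

end Completion

/-! ### The Haagerup tensor product -/

section Haagerup

open LeftOperatorModule RightOperatorModule

section Algebraic

set_option linter.unusedSectionVars false

variable (B F X : Type*) [NonUnitalCStarAlgebra B]
  [NormedAddCommGroup F] [NormedSpace ℂ F] [OperatorSpace F] [RightOperatorModule B F]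
  [NormedAddCommGroup X] [NormedSpace ℂ X] [OperatorSpace X] [LeftOperatorModule B X]

/-- The span of the elements `f b ⊗ x - f ⊗ b x` of `F ⊗ X`. -/
def balancing : Submodule ℂ (F ⊗[ℂ] X) :=
  Submodule.span ℂ {z | ∃ (f : F) (b : B) (x : X), z = ract b f ⊗ₜ[ℂ] x - f ⊗ₜ[ℂ] lact b x}

/-- The algebraic balanced tensor product of `F` and `X` over `B`. -/
def BalTensor : Type _ := (F ⊗[ℂ] X) ⧸ balancing B F X

instance : AddCommGroup (BalTensor B F X) :=
  inferInstanceAs (AddCommGroup ((F ⊗[ℂ] X) ⧸ balancing B F X))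

instance : Module ℂ (BalTensor B F X) :=
  inferInstanceAs (Module ℂ ((F ⊗[ℂ] X) ⧸ balancing B F X))

/-- The bilinear map `(f, x) ↦ f ⊗ x` into the algebraic balanced tensor product. -/
def btmul : F →ₗ[ℂ] X →ₗ[ℂ] BalTensor B F X :=
  (TensorProduct.mk ℂ F X).compr₂ (balancing B F X).mkQ

variable {F X}

/-- The matrix `f ⊙ x` with the entries `∑ k, f i k ⊗ x k j`. -/
def hprod {m n p : Type} [Fintype p] (f : Matrix m p F) (x : Matrix p n X) :
    Matrix m n (BalTensor B F X) :=
  fun i j => ∑ k, btmul B F X (f i k) (x k j)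

variable {B}

lemma btmul_balanced (f : F) (b : B) (x : X) :
    btmul B F X (ract b f) x = btmul B F X f (lact b x) := by
  have : ract b f ⊗ₜ[ℂ] x - f ⊗ₜ[ℂ] lact b x ∈ balancing B F X :=
    Submodule.subset_span ⟨f, b, x, rfl⟩
  exact (Submodule.Quotient.eq _).2 this

/-- The Haagerup seminorm on the matrices over the algebraic balanced tensor product:
the infimum of `‖f‖ ‖x‖` over all factorizations `u = f ⊙ x`. -/
def haagerupNorm {m n : Type} [Fintype m] [Fintype n] (u : Matrix m n (BalTensor B F X)) : ℝ :=
  sInf {r : ℝ | ∃ (p : Type) (_ : Fintype p) (f : Matrix m p F) (x : Matrix p n X),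
    u = hprod B f x ∧ r = mnorm f * mnorm x}

variable {k l m n p q : Type} [Fintype k] [Fintype l] [Fintype m] [Fintype n] [Fintype p]
  [Fintype q]

lemma hprod_fromCols_fromRows (f : Matrix m p F) (g : Matrix m q F) (x : Matrix p n X)
    (y : Matrix q n X) :
    hprod B (Matrix.fromCols f g) (Matrix.fromRows x y) = hprod B f x + hprod B g y := by
  ext i j
  simp [hprod]

lemma btmul_induction {P : BalTensor B F X → Prop} (h0 : P 0)
    (hadd : ∀ u v, P u → P v → P (u + v)) (ht : ∀ f x, P (btmul B F X f x))
    (u : BalTensor B F X) : P u := by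
  obtain ⟨z, rfl⟩ := Submodule.mkQ_surjective (balancing B F X) u
  induction z using TensorProduct.induction_on with
  | zero => rw [map_zero]; exact h0
  | tmul f x => exact ht f x
  | add a b ha hb => rw [map_add]; exact hadd _ _ ha hb

lemma exists_hprod (u : Matrix m n (BalTensor B F X)) :
    ∃ (p : Type) (_ : Fintype p) (f : Matrix m p F) (x : Matrix p n X), u = hprod B f x := by
  classical
  have hadd : ∀ u v : Matrix m n (BalTensor B F X),
      (∃ (p : Type) (_ : Fintype p) (f : Matrix m p F) (x : Matrix p n X), u = hprod B f x) →
      (∃ (p : Type) (_ : Fintype p) (f : Matrix m p F) (x : Matrix p n X), v = hprod B f x) →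
      ∃ (p : Type) (_ : Fintype p) (f : Matrix m p F) (x : Matrix p n X),
        u + v = hprod B f x := by
    rintro _ _ ⟨p, _, f, x, rfl⟩ ⟨q, _, g, y, rfl⟩
    exact ⟨p ⊕ q, inferInstance, _, _, (hprod_fromCols_fromRows f g x y).symm⟩
  have hzero : ∃ (p : Type) (_ : Fintype p) (f : Matrix m p F) (x : Matrix p n X),
      (0 : Matrix m n (BalTensor B F X)) = hprod B f x :=
    ⟨Empty, inferInstance, 0, 0, by ext i j; simp [hprod]⟩
  rw [Matrix.matrix_eq_sum_single u]
  refine Finset.sum_induction _ _ hadd hzero fun i _ => ?_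
  refine Finset.sum_induction _ _ hadd hzero fun j _ => ?_
  refine btmul_induction (P := fun v => ∃ (p : Type) (_ : Fintype p) (f : Matrix m p F)
    (x : Matrix p n X), Matrix.single i j v = hprod B f x) ?_ ?_ ?_ (u i j)
  · simpa using hzero
  · intro u v hu hv
    rw [Matrix.single_add]
    exact hadd _ _ hu hv
  · intro f x
    refine ⟨Unit, inferInstance, fun a _ => if i = a then f else 0,
      fun _ b => if j = b then x else 0, ?_⟩
    ext a b
    by_cases ha : i = a <;> by_cases hb : j = b <;>
      simp [hprod, ha, hb]

lemma haagerupNorm_hprod_le (f : Matrix m p F) (x : Matrix p n X) :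
    haagerupNorm (hprod B f x) ≤ mnorm f * mnorm x := by
  refine csInf_le ⟨0, ?_⟩ ⟨p, inferInstance, f, x, rfl, rfl⟩
  rintro _ ⟨p, _, f, x, _, rfl⟩
  exact mul_nonneg (mnorm_nonneg f) (mnorm_nonneg x)

lemma haagerupNorm_nonneg (u : Matrix m n (BalTensor B F X)) : 0 ≤ haagerupNorm u := by
  apply Real.sInf_nonneg
  rintro _ ⟨p, _, f, x, _, rfl⟩
  exact mul_nonneg (mnorm_nonneg f) (mnorm_nonneg x)

lemma exists_hprod_lt {u : Matrix m n (BalTensor B F X)} {r : ℝ} (h : haagerupNorm u < r) :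
    ∃ (p : Type) (_ : Fintype p) (f : Matrix m p F) (x : Matrix p n X),
      u = hprod B f x ∧ mnorm f * mnorm x < r := by
  obtain ⟨p, _, f, x, hu⟩ := exists_hprod u
  obtain ⟨_, ⟨p, _, f, x, hu, rfl⟩, hr⟩ := exists_lt_of_csInf_lt
    (by exact ⟨_, p, inferInstance, f, x, hu, rfl⟩) h
  exact ⟨p, inferInstance, f, x, hu, hr⟩

lemma exists_hprod_sqrt {u : Matrix m n (BalTensor B F X)} {r : ℝ} (h : haagerupNorm u < r) :
    ∃ (p : Type) (_ : Fintype p) (f : Matrix m p F) (x : Matrix p n X),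
      u = hprod B f x ∧ mnorm f ≤ √r ∧ mnorm x ≤ √r := by
  obtain ⟨p, _, f, x, hu, hr⟩ := exists_hprod_lt h
  have hr0 : 0 < r := (haagerupNorm_nonneg u).trans_lt h
  have hf := mnorm_nonneg f
  have hx := mnorm_nonneg x
  have hs := Real.sqrt_pos.2 hr0
  obtain ⟨a, ha0, ha, hab⟩ : ∃ a, 0 < a ∧ mnorm f ≤ a ∧ a * mnorm x ≤ r := by
    rcases hf.eq_or_lt with h0 | h0
    · refine ⟨r / (mnorm x + 1), by positivity, by rw [← h0]; positivity, ?_⟩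
      rw [div_mul_eq_mul_div, div_le_iff₀ (by positivity)]
      nlinarith
    · exact ⟨mnorm f, h0, le_rfl, hr.le⟩
  have hc : (((√r / a : ℝ)) : ℂ) ≠ 0 := by
    exact_mod_cast (by positivity : √r / a ≠ 0)
  refine ⟨p, inferInstance, ((√r / a : ℝ) : ℂ) • f, ((√r / a : ℝ) : ℂ)⁻¹ • x, ?_, ?_, ?_⟩
  · rw [hu]
    ext i j
    simp only [hprod, Matrix.smul_apply, map_smul, LinearMap.smul_apply]
    refine Finset.sum_congr rfl fun k _ => ?_
    rw [smul_smul, inv_mul_cancel₀ hc, one_smul]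
  · rw [mnorm_smul, Complex.norm_real, Real.norm_of_nonneg (by positivity)]
    calc √r / a * mnorm f ≤ √r / a * a := by gcongr
      _ = √r := by field_simp
  · rw [mnorm_smul, norm_inv, Complex.norm_real, Real.norm_of_nonneg (by positivity), inv_div,
      div_mul_eq_mul_div, div_le_iff₀ hs, Real.mul_self_sqrt hr0.le]
    exact hab

lemma le_mul_haagerupNorm {c t : ℝ} (hc : 0 ≤ c) (u : Matrix m n (BalTensor B F X))
    (h : ∀ (p : Type) [Fintype p] (f : Matrix m p F) (x : Matrix p n X),
      u = hprod B f x → t ≤ c * (mnorm f * mnorm x)) : t ≤ c * haagerupNorm u := by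
  obtain ⟨p, _, f, x, hu⟩ := exists_hprod u
  rcases hc.eq_or_lt with rfl | hc'
  · simpa using h p f x hu
  · rw [← div_le_iff₀' hc']
    refine le_csInf (by exact ⟨_, p, inferInstance, f, x, hu, rfl⟩) ?_
    rintro _ ⟨q, _, g, y, hv, rfl⟩
    rw [div_le_iff₀' hc']
    exact h q g y hv

lemma haagerupNorm_submatrix_le (u : Matrix m n (BalTensor B F X)) {e : k → m} {e' : l → n}
    (he : Function.Injective e) (he' : Function.Injective e') :
    haagerupNorm (u.submatrix e e') ≤ haagerupNorm u := by
  rw [← one_mul (haagerupNorm u)]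
  refine le_mul_haagerupNorm zero_le_one u fun p _ f x hu => ?_
  have h : u.submatrix e e' = hprod B (f.submatrix e id) (x.submatrix id e') := by
    rw [hu]; rfl
  rw [h, one_mul]
  refine (haagerupNorm_hprod_le _ _).trans (mul_le_mul (mnorm_submatrix_le _ he
    Function.injective_id) (mnorm_submatrix_le _ Function.injective_id he') (mnorm_nonneg _)
    (mnorm_nonneg _))

instance : RuanSpace (BalTensor B F X) where
  mnorm := haagerupNorm
  mnorm_add_le u v := by
    refine le_of_forall_pos_lt_add fun ε hε => ?_
    obtain ⟨p, _, f, x, rfl, hf, hx⟩ :=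
      exists_hprod_sqrt (lt_add_of_pos_right (haagerupNorm u) (by positivity : 0 < ε / 3))
    obtain ⟨q, _, g, y, rfl, hg, hy⟩ :=
      exists_hprod_sqrt (lt_add_of_pos_right (haagerupNorm v) (by positivity : 0 < ε / 3))
    set r := haagerupNorm (hprod B f x) + ε / 3
    set s := haagerupNorm (hprod B g y) + ε / 3
    have hr : 0 < r := add_pos_of_nonneg_of_pos (haagerupNorm_nonneg _) (by positivity)
    have hs : 0 < s := add_pos_of_nonneg_of_pos (haagerupNorm_nonneg _) (by positivity)
    rw [← hprod_fromCols_fromRows]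
    calc _ ≤ mnorm (Matrix.fromCols f g) * mnorm (Matrix.fromRows x y) :=
          haagerupNorm_hprod_le _ _
      _ ≤ √(r + s) * √(r + s) := by
          gcongr
          · exact mnorm_nonneg _
          · exact mnorm_fromCols_le f g hr hs hf hg
          · exact mnorm_fromRows_le x y hr hs hx hy
      _ = r + s := Real.mul_self_sqrt (by positivity)
      _ < _ := by simp only [r, s]; linarith
  mnorm_scalarMul_le α u := by
    refine le_mul_haagerupNorm (norm_nonneg α) u fun p _ f x hu => ?_
    have h : scalarMul α u = hprod B (scalarMul α f) x := by
      ext i j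
      simp only [hu, scalarMul, hprod, map_sum, map_smul, LinearMap.sum_apply,
        LinearMap.smul_apply, Finset.smul_sum]
      exact Finset.sum_comm
    rw [h, ← mul_assoc]
    exact (haagerupNorm_hprod_le _ _).trans (mul_le_mul_of_nonneg_right
      (RuanSpace.mnorm_scalarMul_le α f) (mnorm_nonneg x))
  mnorm_mulScalar_le u β := by
    rw [mul_comm]
    refine le_mul_haagerupNorm (norm_nonneg β) u fun p _ f x hu => ?_
    have h : mulScalar u β = hprod B f (mulScalar x β) := by
      ext i j
      simp only [hu, mulScalar, hprod, map_sum, map_smul, Finset.smul_sum]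
      exact Finset.sum_comm
    rw [h]
    refine (haagerupNorm_hprod_le _ _).trans ((mul_le_mul_of_nonneg_left
      (RuanSpace.mnorm_mulScalar_le x β) (mnorm_nonneg f)).trans (le_of_eq ?_))
    ring
  mnorm_fromBlocks u v := by
    refine le_antisymm (le_of_forall_gt_imp_ge_of_dense fun r hr => ?_) (max_le ?_ ?_)
    · obtain ⟨p, _, f, x, hu, hf, hx⟩ := exists_hprod_sqrt ((le_max_left _ _).trans_lt hr)
      obtain ⟨q, _, g, y, hv, hg, hy⟩ := exists_hprod_sqrt ((le_max_right _ _).trans_lt hr)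
      have hr0 : 0 ≤ r := ((haagerupNorm_nonneg u).trans (le_max_left _ _)).trans hr.le
      have h : Matrix.fromBlocks u 0 0 v =
          hprod B (Matrix.fromBlocks f 0 0 g) (Matrix.fromBlocks x 0 0 y) := by
        ext i j
        rcases i with i | i <;> rcases j with j | j <;> simp [hprod, hu, hv]
      rw [h]
      refine (haagerupNorm_hprod_le _ _).trans ?_
      rw [RuanSpace.mnorm_fromBlocks, RuanSpace.mnorm_fromBlocks, ← Real.mul_self_sqrt hr0]
      exact mul_le_mul (max_le hf hg) (max_le hx hy) ((mnorm_nonneg x).trans (le_max_left _ _))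
        (Real.sqrt_nonneg r)
    · exact haagerupNorm_submatrix_le (Matrix.fromBlocks u 0 0 v) Sum.inl_injective
        Sum.inl_injective
    · exact haagerupNorm_submatrix_le (Matrix.fromBlocks u 0 0 v) Sum.inr_injective
        Sum.inr_injective

/-- The seminorm of the algebraic balanced tensor product is the seminorm of `1 × 1` matrices. -/
instance : SeminormedAddCommGroup (BalTensor B F X) :=
  AddGroupSeminorm.toSeminormedAddCommGroup
    { toFun := fun u => mnorm (unitMat u)
      map_zero' := mnorm_zero
      add_le' := fun u v => RuanSpace.mnorm_add_le (unitMat u) (unitMat v)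
      neg' := fun u => by
        have h : unitMat (-u) = (-1 : ℂ) • unitMat u := by ext i j; simp [unitMat]
        rw [h, mnorm_smul]
        simp }

lemma norm_balTensor (u : BalTensor B F X) : ‖u‖ = mnorm (unitMat u) := rfl

instance : NormedSpace ℂ (BalTensor B F X) where
  norm_smul_le c u := mnorm_smul_le c (unitMat u)

instance : CompatibleNorm (BalTensor B F X) := ⟨fun _ => rfl⟩

end Algebraic

/-- The Haagerup tensor product `F ⊗^h_B X`: the Hausdorff completion of the algebraic balanced
tensor product for the Haagerup matrix seminorms, with the matrix norms extended by continuity. -/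
abbrev HaagerupTensor (B F X : Type*) [NonUnitalCStarAlgebra B]
    [NormedAddCommGroup F] [NormedSpace ℂ F] [OperatorSpace F] [RightOperatorModule B F]
    [NormedAddCommGroup X] [NormedSpace ℂ X] [OperatorSpace X] [LeftOperatorModule B X] :
    Type _ :=
  UniformSpace.Completion (BalTensor B F X)

section Functorial

variable {A B : Type*} [NonUnitalCStarAlgebra A] [NonUnitalCStarAlgebra B]
variable {F : Type*} [NormedAddCommGroup F] [NormedSpace ℂ F] [OperatorSpace F]
variable {X : Type*} [NormedAddCommGroup X] [NormedSpace ℂ X] [OperatorSpace X]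
  [LeftOperatorModule B X]
variable {Y : Type*} [NormedAddCommGroup Y] [NormedSpace ℂ Y] [OperatorSpace Y]
  [LeftOperatorModule B Y]

section Action

variable [OperatorBimodule A B F]

/-- The action of `A` on the algebraic balanced tensor product, `a (f ⊗ x) = (a f) ⊗ x`. -/
def balAct (a : A) : BalTensor B F X →ₗ[ℂ] BalTensor B F X :=
  Submodule.mapQ (balancing B F X) (balancing B F X)
    (TensorProduct.map (lact a : F →ₗ[ℂ] F) LinearMap.id) <| by
    rw [balancing, Submodule.span_le]
    rintro _ ⟨f, b, x, rfl⟩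
    refine Submodule.subset_span ⟨lact a f, b, x, ?_⟩
    simp [OperatorBimodule.lact_ract]

lemma balAct_btmul (a : A) (f : F) (x : X) :
    balAct a (btmul B F X f x) = btmul B F X (lact a f) x := rfl

lemma balAct_mnorm_le {m n : Type} [Fintype m] [Fintype n] (a : Matrix m m A)
    (u : Matrix m n (BalTensor B F X)) :
    mnorm (fun i j => ∑ k, balAct (a i k) (u k j) : Matrix m n (BalTensor B F X)) ≤
      cstarMatrixNorm a * mnorm u := by
  refine le_mul_haagerupNorm (cstarMatrixNorm_nonneg a) u fun p _ f x hu => ?_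
  have h : (fun i j => ∑ k, balAct (a i k) (u k j) : Matrix m n (BalTensor B F X)) =
      hprod B (lmul a f) x := by
    ext i j
    simp only [hu, lmul, hprod, map_sum, LinearMap.sum_apply, balAct_btmul]
    exact Finset.sum_comm
  rw [h, ← mul_assoc]
  exact (haagerupNorm_hprod_le _ _).trans (mul_le_mul_of_nonneg_right
      (mnorm_lmul_le a f) (mnorm_nonneg x))

/-- The action of `a ∈ A` as a continuous map. -/
def balActL (a : A) : BalTensor B F X →L[ℂ] BalTensor B F X :=
  (balAct a).mkContinuous (cstarMatrixNorm (unitMat a)) fun u => by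
    have h := balAct_mnorm_le (unitMat a) (unitMat u)
    simp only [unitMat, Finset.univ_unique, Finset.sum_singleton] at h
    exact h

lemma balActL_btmul (a : A) (f : F) (x : X) :
    balActL a (btmul B F X f x) = btmul B F X (lact a f) x := rfl

lemma balTensor_ext {W : Type*} [SeminormedAddCommGroup W] [NormedSpace ℂ W]
    [RightOperatorModule B F] {S T : BalTensor B F X →L[ℂ] W}
    (h : ∀ f x, S (btmul B F X f x) = T (btmul B F X f x)) : S = T := by
  ext u
  induction u using btmul_induction with
  | h0 => rw [map_zero, map_zero]
  | hadd u v hu hv => rw [map_add, map_add, hu, hv]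
  | ht f x => exact h f x

lemma balActL_add (a b : A) :
    (balActL (a + b) : BalTensor B F X →L[ℂ] BalTensor B F X) = balActL a + balActL b :=
  balTensor_ext fun f x => by
    rw [_root_.add_apply, balActL_btmul, balActL_btmul, balActL_btmul, map_add,
      LinearMap.add_apply, map_add, LinearMap.add_apply]

lemma balActL_smul (c : ℂ) (a : A) :
    (balActL (c • a) : BalTensor B F X →L[ℂ] BalTensor B F X) = c • balActL a :=
  balTensor_ext fun f x => by
    rw [_root_.smul_apply, balActL_btmul, balActL_btmul, map_smul,
      LinearMap.smul_apply, map_smul, LinearMap.smul_apply]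

lemma balActL_mul (a b : A) :
    (balActL (a * b) : BalTensor B F X →L[ℂ] BalTensor B F X) =
      (balActL a).comp (balActL b) :=
  balTensor_ext fun f x => by
    rw [ContinuousLinearMap.comp_apply, balActL_btmul, balActL_btmul, balActL_btmul, lact_mul]

/-- The Haagerup tensor product is a left operator `A`-module, with the action determined by
`a (f ⊗ x) = (a f) ⊗ x`. -/
instance : LeftOperatorModule A (HaagerupTensor B F X) where
  lact :=
    { toFun := fun a => (balActL (B := B) (F := F) (X := X) a).completion.toLinearMap
      map_add' := fun a b => by rw [balActL_add, completion_add]; rfl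
      map_smul' := fun c a => by rw [balActL_smul, completion_smul]; rfl }
  lact_mul a b z := by
    have h := completion_comp_apply (balActL (B := B) (F := F) (X := X) a) (balActL b) z
    rw [← balActL_mul] at h
    exact h
  mnorm_lact_le a z :=
    mnorm_sum_completion_le (Matrix.of fun i k => balActL (B := B) (F := F) (X := X) (a i k))
      (balAct_mnorm_le a) z

end Action

section IdTensor

variable [RightOperatorModule B F]

/-- The map `id_F ⊗ t` of algebraic balanced tensor products, `f ⊗ x ↦ f ⊗ t x`. -/
def balMap (t : CBMod B X Y) : BalTensor B F X →ₗ[ℂ] BalTensor B F Y :=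
  Submodule.mapQ (balancing B F X) (balancing B F Y)
    (TensorProduct.map LinearMap.id (t : X →ₗ[ℂ] Y)) <| by
    rw [balancing, Submodule.span_le]
    rintro _ ⟨f, b, x, rfl⟩
    refine Submodule.subset_span ⟨f, b, (t : X →ₗ[ℂ] Y) x, ?_⟩
    simp [t.2.2 b x]

lemma balMap_btmul (t : CBMod B X Y) (f : F) (x : X) :
    balMap t (btmul B F X f x) = btmul B F Y f ((t : X →ₗ[ℂ] Y) x) := rfl

lemma mnorm_balMap_le (t : CBMod B X Y) {C : ℝ} (hC : 0 ≤ C) (h : IsCBBound (t : X →ₗ[ℂ] Y) C)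
    {m n : Type} [Fintype m] [Fintype n] (u : Matrix m n (BalTensor B F X)) :
    mnorm (u.map (balMap t)) ≤ C * mnorm u := by
  refine le_mul_haagerupNorm hC u fun p _ f x hu => ?_
  have e : u.map (balMap t) = hprod B f (x.map (t : X →ₗ[ℂ] Y)) := by
    ext i j
    simp [hu, hprod, balMap_btmul]
  rw [e, mul_left_comm]
  exact (haagerupNorm_hprod_le _ _).trans (mul_le_mul_of_nonneg_left (h.rect x) (mnorm_nonneg f))

/-- The continuous map `id_F ⊗ t` of algebraic balanced tensor products. -/
def balMapL (t : CBMod B X Y) : BalTensor B F X →L[ℂ] BalTensor B F Y :=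
  (balMap t).mkContinuousOfExistsBound <| by
    obtain ⟨C, hC, h⟩ := t.2.1
    exact ⟨C, fun u => mnorm_balMap_le t hC h (unitMat u)⟩

lemma balMapL_btmul (t : CBMod B X Y) (f : F) (x : X) :
    balMapL t (btmul B F X f x) = btmul B F Y f ((t : X →ₗ[ℂ] Y) x) := rfl

end IdTensor

lemma lact_haagerup [OperatorBimodule A B F] (a : A) (z : HaagerupTensor B F X) :
    lact a z = (balActL a).completion z := rfl

/-- The map `id_F ⊗ t : F ⊗^h_B X → F ⊗^h_B Y`, the continuous extension of
`f ⊗ x ↦ f ⊗ t x`. -/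
def idTensorMap [RightOperatorModule B F] (t : CBMod B X Y) :
    HaagerupTensor B F X →ₗ[ℂ] HaagerupTensor B F Y :=
  (balMapL t).completion.toLinearMap

lemma idTensorMap_mem [OperatorBimodule A B F] (t : CBMod B X Y) :
    (idTensorMap t : HaagerupTensor B F X →ₗ[ℂ] HaagerupTensor B F Y) ∈
      CBMod A (HaagerupTensor B F X) (HaagerupTensor B F Y) := by
  constructor
  · obtain ⟨C, hC, h⟩ := t.2.1
    exact ⟨C, hC, fun z => mnorm_map_completion_le (balMapL t) (mnorm_balMap_le t hC h) z⟩
  · intro a z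
    have e : (balMapL (F := F) t).comp (balActL a) = (balActL a).comp (balMapL t) :=
      balTensor_ext fun f x => rfl
    have h1 := completion_comp_apply (balMapL (F := F) t) (balActL a) z
    rw [e, completion_comp_apply] at h1
    exact h1.symm

lemma balMapL_add [RightOperatorModule B F] (s t : CBMod B X Y) :
    (balMapL (s + t) : BalTensor B F X →L[ℂ] BalTensor B F Y) = balMapL s + balMapL t :=
  balTensor_ext fun f x => by
    rw [_root_.add_apply, balMapL_btmul, balMapL_btmul, balMapL_btmul,
      Submodule.coe_add, LinearMap.add_apply, map_add]

lemma balMapL_smul [RightOperatorModule B F] (c : ℂ) (t : CBMod B X Y) :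
    (balMapL (c • t) : BalTensor B F X →L[ℂ] BalTensor B F Y) = c • balMapL t :=
  balTensor_ext fun f x => by
    rw [_root_.smul_apply, balMapL_btmul, balMapL_btmul,
      Submodule.coe_smul, LinearMap.smul_apply, map_smul]

/-- The map `CB_B(X, Y) → CB_A(F ⊗^h_B X, F ⊗^h_B Y)` which sends `t` to `id_F ⊗ t`. -/
def idTensor (A B F X Y : Type*) [NonUnitalCStarAlgebra A] [NonUnitalCStarAlgebra B]
    [NormedAddCommGroup F] [NormedSpace ℂ F] [OperatorSpace F] [OperatorBimodule A B F]
    [NormedAddCommGroup X] [NormedSpace ℂ X] [OperatorSpace X] [LeftOperatorModule B X]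
    [NormedAddCommGroup Y] [NormedSpace ℂ Y] [OperatorSpace Y] [LeftOperatorModule B Y] :
    CBMod B X Y →ₗ[ℂ] CBMod A (HaagerupTensor B F X) (HaagerupTensor B F Y) where
  toFun t := ⟨idTensorMap t, idTensorMap_mem t⟩
  map_add' s t := Subtype.ext <| by
    change (balMapL (s + t)).completion.toLinearMap = _
    rw [balMapL_add, completion_add]
    rfl
  map_smul' c t := Subtype.ext <| by
    change (balMapL (c • t)).completion.toLinearMap = _
    rw [balMapL_smul, completion_smul]
    rfl

lemma idTensor_btmul [OperatorBimodule A B F] (t : CBMod B X Y) (f : F) (x : X) :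
    (idTensor A B F X Y t : HaagerupTensor B F X →ₗ[ℂ] HaagerupTensor B F Y)
      (btmul B F X f x : BalTensor B F X) =
      (btmul B F Y f ((t : X →ₗ[ℂ] Y) x) : BalTensor B F Y) :=
  ContinuousLinearMap.completion_apply_coe (balMapL t) _

end Functorial

end Haagerup

end OpSp

end

/-! Regard a matrix `t = [t i j]` in `M_n(CB_B(X, Y))` as one completely bounded map `X → M_n(Y)`.
If a matrix `u` over the algebraic tensor product is factored as `u = f ⊙ x`, then applying `id ⊗ t`
to it gives `(id ⊗ t)(f ⊙ x) = (1_n ⊗ f) ⊙ t(x)`, where `1_n ⊗ f` is block diagonal with `n` copies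
of `f`, and `t(x)` is the amplification of `t` at `x` (`amplify_balMap_hprod`). The index over which
`f` and `x` are multiplied grows from `p` to `n × p`, which the Haagerup norm permits because it is
an infimum over inner sizes of every kind.

Two estimates then suffice. Ruan's direct sum axiom gives `‖1_n ⊗ f‖ ≤ ‖f‖`
(`mnorm_diagAmplify_le`), and any bound `C` for the amplifications of `t` gives `‖t(x)‖ ≤ C ‖x‖`.
Since the inner size `p` is unrelated to the outer sizes, `x` is rectangular in general, whereas the
completely bounded norm tests square matrices only; `mnorm_amplify_le_of_square` bridges the gap.
Taking the infimum over all factorizations shows that `C` also bounds the amplifications of `id ⊗ t`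
on the algebraic tensor product, and density carries this to the completion
(`mnorm_amplify_idTensorMap_le`).

Thus every bound for `t` is a bound for `id ⊗ t`, and the two completely bounded norms, being infima
of bounds, compare as claimed. The comparison needs `t` to have at least one bound, because a real
infimum over the empty set is `0` by convention; `exists_mnorm_amplify_le` supplies one. Linearity
over `B` enters only in making `id ⊗ t` well defined on the balanced tensor product, not in the
estimates. -/

noncomputable section

namespace OpSp

open scoped Matrix.Norms.L2Operator
open MatrixNorms (mnorm)

/-! ### Block diagonal ampliations and Ruan's direct sum axiom -/

section Ampliation

variable {V : Type*} [AddCommGroup V] [Module ℂ V] [RuanSpace V]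

/-- The block diagonal matrix `1 ⊗ f`, with one copy of `f` for each element of `ι`. -/
def diagAmplify (ι : Type) {m p : Type} (f : Matrix m p V) : Matrix (ι × m) (ι × p) V := by
  classical exact fun a b => if a.1 = b.1 then f a.2 b.2 else 0

/-- A block diagonal ampliation has at most the norm of its block. -/
lemma mnorm_diagAmplify_le (ι : Type) [Fintype ι] {m p : Type} [Fintype m] [Fintype p]
    (f : Matrix m p V) : mnorm (diagAmplify ι f) ≤ mnorm f := by
  classical
  -- Ruan's axiom adds one diagonal block at a time, so the proof is an induction on the set of
  -- copies. Indexing the copies by finite subsets of `ι` makes this possible without enumerating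
  -- `ι`.
  suffices h : ∀ s : Finset ι, mnorm (diagAmplify s f) ≤ mnorm f by
    refine le_trans ?_ (h Finset.univ)
    let e (q : Type) : ι × q → ((Finset.univ : Finset ι) : Type) × q :=
      fun a => (⟨a.1, Finset.mem_univ _⟩, a.2)
    have he (q : Type) : Function.Injective (e q) := by
      rintro ⟨i, a⟩ ⟨j, b⟩ hab
      simpa [e] using hab
    -- The types `ι` and `Finset.univ` differ only by a relabelling of rows and columns, and an
    -- injective relabelling does not increase the norm.
    have h1 : diagAmplify ι f = (diagAmplify (Finset.univ : Finset ι) f).submatrix (e m) (e p) := by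
      ext a b
      simp [diagAmplify, e]
    rw [h1]
    exact mnorm_submatrix_le _ (he m) (he p)
  intro s
  induction s using Finset.induction_on with
  | empty =>
    have h0 : diagAmplify (∅ : Finset ι) f = 0 := by
      ext a b
      exact absurd a.1.2 (Finset.notMem_empty _)
    rw [h0, mnorm_zero]
    exact mnorm_nonneg f
  | insert i s hi ih =>
    -- This relabelling splits off the copy at `i` from the copies in `s`. It serves rows (`q = m`)
    -- and columns (`q = p`) alike. Injectivity is all that the submatrix estimate asks for.
    let e (q : Type) : ((insert i s : Finset ι) : Type) × q → q ⊕ (s × q) := fun a =>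
      if h : a.1.1 = i then Sum.inl a.2
      else Sum.inr (⟨a.1.1, (Finset.mem_insert.1 a.1.2).resolve_left h⟩, a.2)
    have he (q : Type) : Function.Injective (e q) := by
      rintro ⟨⟨j, hj⟩, a⟩ ⟨⟨k, hk⟩, b⟩ hab
      by_cases h1 : j = i <;> by_cases h2 : k = i <;> simp_all [e]
    -- The two mixed cases, with exactly one of `j`, `k` equal to `i`, are the zero off-diagonal
    -- blocks; for `j` and `k` both different from `i`, the entry is that of the smaller ampliation.
    have h1 : diagAmplify (insert i s : Finset ι) f =
        (Matrix.fromBlocks f 0 0 (diagAmplify s f)).submatrix (e m) (e p) := by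
      ext ⟨⟨j, hj⟩, a⟩ ⟨⟨k, hk⟩, b⟩
      by_cases h1 : j = i <;> by_cases h2 : k = i
      · simp [diagAmplify, e, h1, h2]
      · simp [diagAmplify, e, h1, h2, Ne.symm h2]
      · simp [diagAmplify, e, h1, h2]
      · simp [diagAmplify, e, h1, h2]
    rw [h1]
    refine (mnorm_submatrix_le _ (he m) (he p)).trans ?_
    rw [RuanSpace.mnorm_fromBlocks]
    exact max_le le_rfl ih

end Ampliation

/-! ### Bounds for matrices of completely bounded maps -/

section CompletelyBounded

variable {X Y : Type*} [AddCommGroup X] [Module ℂ X] [AddCommGroup Y] [Module ℂ Y]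
  [RuanSpace X] [RuanSpace Y]
variable {k l m n : Type} [Fintype k] [Fintype l] [Fintype m] [Fintype n]

/-- A bound for a matrix of linear maps on square matrices also holds on rectangular matrices. -/
lemma mnorm_amplify_le_of_square {t : Matrix m n (X →ₗ[ℂ] Y)} {C : ℝ}
    (h : ∀ {k : Type} [Fintype k] (x : Matrix k k X), mnorm (amplify t x) ≤ C * mnorm x)
    (x : Matrix k l X) : mnorm (amplify t x) ≤ C * mnorm x := by
  -- Padding by zeros makes `x` square of size `k ⊕ l` without changing its norm.
  have h1 := h (Matrix.fromBlocks 0 x (0 : Matrix l k X) 0)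
  rw [mnorm_fromBlocks_zero] at h1
  -- The matrix indices of `t` come first, so the padded amplification has rows in `m × (k ⊕ l)` and
  -- columns in `n × (k ⊕ l)`. The part coming from `x` is spread over all the blocks, and is
  -- recovered by choosing `inl` rows and `inr` columns in each.
  have h2 : amplify t x = (amplify t (Matrix.fromBlocks 0 x (0 : Matrix l k X) 0)).submatrix
      (Prod.map id Sum.inl) (Prod.map id Sum.inr) := by
    ext a b
    simp [amplify]
  rw [h2]
  exact (mnorm_submatrix_le _ (Function.injective_id.prodMap Sum.inl_injective)
    (Function.injective_id.prodMap Sum.inr_injective)).trans h1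

/-- The norm of a block matrix is at most the sum of the norms of its blocks. -/
lemma mnorm_le_sum_blocks (y : Matrix (m × k) (n × l) Y) :
    mnorm y ≤ ∑ i, ∑ j, mnorm (y.submatrix (Prod.mk i) (Prod.mk j)) := by
  classical
  -- Each block is put back in its place by scalar matrices: `y = ∑ Sᵢ* yᵢⱼ Sⱼ`, where `Sᵢ` selects
  -- the indices with first component `i` and has norm at most `1`. The triangle inequality then
  -- gives the crude estimate.
  have h : y = ∑ i, ∑ j, mulScalar (scalarMul (selMat (Prod.mk i)).conjTranspose
      (y.submatrix (Prod.mk i) (Prod.mk j))) (selMat (Prod.mk j)) := by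
    ext ⟨a, a'⟩ ⟨b, b'⟩
    simp [Matrix.sum_apply, mulScalar, scalarMul, selMat, Matrix.conjTranspose_apply, ite_smul,
      apply_ite star, ite_and]
  conv_lhs => rw [h]
  refine (mnorm_sum_le _ _).trans (Finset.sum_le_sum fun i _ => ?_)
  refine (mnorm_sum_le _ _).trans (Finset.sum_le_sum fun j _ => ?_)
  set z := y.submatrix (Prod.mk i) (Prod.mk j)
  have hz := mnorm_nonneg z
  calc _ ≤ mnorm (scalarMul (selMat (Prod.mk i)).conjTranspose z) * ‖selMat (Prod.mk j)‖ :=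
        RuanSpace.mnorm_mulScalar_le _ _
    _ ≤ (‖(selMat (Prod.mk i)).conjTranspose‖ * mnorm z) * ‖selMat (Prod.mk j)‖ := by
        gcongr; exact RuanSpace.mnorm_scalarMul_le _ _
    _ ≤ (1 * mnorm z) * 1 := by
        rw [Matrix.l2_opNorm_conjTranspose]
        gcongr
        · exact norm_selMat_le (Prod.mk_right_injective i)
        · exact norm_selMat_le (Prod.mk_right_injective j)
    _ = mnorm z := by ring

/-- A matrix of completely bounded maps is a completely bounded map to matrices. -/
lemma exists_mnorm_amplify_le {t : Matrix m n (X →ₗ[ℂ] Y)}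
    (ht : ∀ i j, IsCompletelyBounded (t i j)) :
    ∃ C : ℝ, 0 ≤ C ∧ ∀ {k : Type} [Fintype k] (x : Matrix k k X),
      mnorm (amplify t x) ≤ C * mnorm x := by
  choose C hC h using ht
  -- The sum of the entrywise bounds is far from optimal, but only the existence of some bound
  -- independent of `k` matters. The `(i, j)` block of `amplify t x` is `x.map (t i j)`, to which
  -- the bound `C i j` applies.
  refine ⟨∑ i, ∑ j, C i j, Finset.sum_nonneg fun i _ => Finset.sum_nonneg fun j _ => hC i j,
    fun x => (mnorm_le_sum_blocks _).trans ?_⟩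
  simp_rw [Finset.sum_mul]
  exact Finset.sum_le_sum fun i _ => Finset.sum_le_sum fun j _ => h i j x

end CompletelyBounded

/-! ### Amplifications of `id ⊗ t` on the Haagerup tensor product -/

section IdTensor

variable {B F X Y : Type*} [NonUnitalCStarAlgebra B]
  [NormedAddCommGroup F] [NormedSpace ℂ F] [OperatorSpace F] [RightOperatorModule B F]
  [NormedAddCommGroup X] [NormedSpace ℂ X] [OperatorSpace X] [LeftOperatorModule B X]
  [NormedAddCommGroup Y] [NormedSpace ℂ Y] [OperatorSpace Y] [LeftOperatorModule B Y]
variable {k l m n : Type} [Fintype m]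

/-- On elementary products, `id ⊗ t` acts by `f ⊙ x ↦ (1 ⊗ f) ⊙ t x`. -/
lemma amplify_balMap_hprod {p : Type} [Fintype p] (t : Matrix m n (CBMod B X Y))
    (f : Matrix k p F) (x : Matrix p l X) :
    amplify (fun i j => balMap (F := F) (t i j)) (hprod B f x) =
      hprod B (diagAmplify m f) (amplify (fun i j => (t i j : X →ₗ[ℂ] Y)) x) := by
  classical
  ext ⟨i, a⟩ ⟨j, b⟩
  -- This moves the Kronecker delta of `1 ⊗ f` out of the tensor, so that it can be summed away.
  have h (c : Prop) [Decidable c] (g : F) (y : Y) :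
      btmul B F Y (if c then g else 0) y = if c then btmul B F Y g y else 0 := by
    split_ifs <;> simp
  simp only [amplify, hprod, diagAmplify, map_sum, balMap_btmul, Fintype.sum_prod_type, h]
  -- The inner index on the right runs over `m × p`. With the sum over `m` innermost, the delta
  -- leaves only the term with index `i`, which is the sum over `p` on the left.
  rw [Finset.sum_comm]
  simp

variable [Fintype k] [Fintype l] [Fintype n]

/-- A bound for the amplifications of `t` is one for `id ⊗ t` on the algebraic tensor product. -/
lemma mnorm_amplify_balMap_le {t : Matrix m n (CBMod B X Y)} {C : ℝ} (hC : 0 ≤ C)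
    (h : ∀ {k : Type} [Fintype k] (x : Matrix k k X),
      mnorm (amplify (fun i j => (t i j : X →ₗ[ℂ] Y)) x) ≤ C * mnorm x)
    (u : Matrix k l (BalTensor B F X)) :
    mnorm (amplify (fun i j => balMap (F := F) (t i j)) u) ≤ C * mnorm u := by
  -- It is enough to treat each factorization `u = f ⊙ x` separately, since the norm of `u` is the
  -- infimum of `‖f‖ ‖x‖`.
  refine le_mul_haagerupNorm hC u fun p _ f x hu => ?_
  rw [hu, amplify_balMap_hprod, mul_left_comm]
  -- The new factorization `(1 ⊗ f) ⊙ t(x)` need not be optimal; its cost is at most `‖f‖ · C ‖x‖`.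
  -- The rectangular form of the bound is needed because `x` has `p` rows and `l` columns.
  exact (haagerupNorm_hprod_le _ _).trans (mul_le_mul (mnorm_diagAmplify_le m f)
    (mnorm_amplify_le_of_square h x) (mnorm_nonneg _) (mnorm_nonneg f))

/-- A bound for the amplifications of `t` is a bound for those of `id ⊗ t`. -/
lemma mnorm_amplify_idTensorMap_le {t : Matrix m n (CBMod B X Y)} {C : ℝ} (hC : 0 ≤ C)
    (h : ∀ {k : Type} [Fintype k] (x : Matrix k k X),
      mnorm (amplify (fun i j => (t i j : X →ₗ[ℂ] Y)) x) ≤ C * mnorm x)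
    (z : Matrix k l (HaagerupTensor B F X)) :
    mnorm (amplify (fun i j => idTensorMap (F := F) (t i j)) z) ≤ C * mnorm z := by
  refine matCoe_induction
    (P := fun z => mnorm (amplify (fun i j => idTensorMap (F := F) (t i j)) z) ≤ C * mnorm z)
    z ?_ fun u => ?_
  -- The inequality is a closed condition on `z`: the matrix norm on the completion is continuous,
  -- and each entry of the amplification is a continuous map applied to a single entry of `z`.
  · refine isClosed_le (continuous_mnorm_completion.comp ?_)
      (continuous_const.mul continuous_mnorm_completion)
    refine continuous_pi fun a => continuous_pi fun b => ?_
    exact (balMapL (F := F) (t a.1 b.1)).completion.continuous.comp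
      (continuous_apply_apply a.2 b.2)
  -- On the dense set of matrices over the algebraic tensor product, the extended maps agree with
  -- the original ones, so the algebraic estimate applies.
  · have e : amplify (fun i j => idTensorMap (F := F) (t i j)) (matCoe u) =
        matCoe (amplify (fun i j => balMap (F := F) (t i j)) u) := by
      ext a b
      exact ContinuousLinearMap.completion_apply_coe (balMapL (F := F) (t a.1 b.1)) _
    rw [e, mnorm_matCoe, mnorm_matCoe]
    exact mnorm_amplify_balMap_le hC h u

end IdTensor

end OpSp

end

/-- For an operator `A`-`B`-bimodule `F` and left operator `B`-modules `X`, `Y`, the map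
`CB_B(X, Y) → CB_A(F ⊗^h_B X, F ⊗^h_B Y)`, `t ↦ id_F ⊗ t`, is completely contractive. -/
theorem mainTheorem9 {A B F X Y : Type*} [NonUnitalCStarAlgebra A] [NonUnitalCStarAlgebra B]
    [NormedAddCommGroup F] [NormedSpace ℂ F] [OpSp.OperatorSpace F] [OpSp.OperatorBimodule A B F]
    [NormedAddCommGroup X] [NormedSpace ℂ X] [OpSp.OperatorSpace X] [OpSp.LeftOperatorModule B X]
    [NormedAddCommGroup Y] [NormedSpace ℂ Y] [OpSp.OperatorSpace Y] [OpSp.LeftOperatorModule B Y] :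
    OpSp.IsCompletelyContractive (OpSp.idTensor A B F X Y) := by
  intro n _ t
  rw [one_mul]
  -- Both sides are infima of sets of bounds, so an inclusion of these sets suffices. Bounds are
  -- nonnegative by definition, and the set for `t` is nonempty because its entries are completely
  -- bounded.
  refine csInf_le_csInf ⟨0, fun _ h => h.1⟩
    (OpSp.exists_mnorm_amplify_le fun i j => (t i j).2.1) ?_
  rintro C ⟨hC, h⟩
  exact ⟨hC, fun z => OpSp.mnorm_amplify_idTensorMap_le hC h z⟩
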